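/- Let $s\ge -\tfrac12$ and $k\ge 1$, let $\mathbb R^{+}=[0,\infty)$, and let $\mathcal P(E)$ denote the set of Borel probability measures on $E$ with the topology of weak convergence. Notation. Let $\Lambda_s(x)=\Gamma(s+1)J_s(x)/(x/2)^s$ for $x>0$ and $\Lambda_s(0)=1$, where $J_s$ is the Bessel function of the first kind. Let $F_s$ be the symmetric probability measure on $[-1,1]$ with density $\frac{\Gamma(s+1)}{\sqrt\pi\,\Gamma(s+1/2)}(1-u^2)^{s-1/2}$ if $s>-\tfrac12$, and $F_{-1/2}=\tfrac12(\delta_1+\delta_{-1})$. For $x,y\in\mathbb R^+$ let $\delta_x\circ_s\delta_y$ be the law of $(x^2+2\theta xy+y^2)^{1/2}$, where $\theta$ has law $F_s$. For $\mathbf x,\mathbf y\in(\mathbb R^{+})^k$ put $\delta_{\mathbf x}\bigcirc_{s,k}\delta_{\mathbf y}=(\delta_{x_1}\circ_s\delta_{y_1})\times\cdots\times(\delta_{x_k}\circ_s\delta_{y_k})$, and for $\mathbf G_1,\mathbf G_2\in\mathcal P((\mathbb R^{+})^k)$ put $\mathbf G_1\bigcirc_{s,k}\mathbf G_2=\iint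 \delta_{\mathbf x}\bigcirc_{s,k}\delta_{\mathbf y}\,\mathbf G_1(d\mathbf x)\,\mathbf G_2(d\mathbf y)$. The radial characteristic function of $\mathbf G$ is $\hat{\mathbf G}(\mathbf t)=\int\prod_{j=1}^k\Lambda_s(t_jx_j)\,\mathbf G(d\mathbf x)$, $\mathbf t\in(\mathbb R^{+})^k$. Write $T_c$ for the map taking the law of $X$ to the law of $cX$, and define $F_{s,k}:\mathcal P((\mathbb R^{+})^k)\to\mathcal P(\mathbb R^k)$ by $$F_{s,k}(\mathbf G)=\int (T_{c_1}F_s)\times\cdots\times(T_{c_k}F_s)\,\mathbf G(d\mathbf c).$$ Let $\sigma_s$ be the law on $(0,\infty)$ with density $\frac{2(s+1)^{s+1}}{\Gamma(s+1)}y^{2s+1}e^{-(s+1)y^2}$ and let $\Sigma_{s,k}=\sigma_s\times\cdots\times\sigma_s$ ($k$ factors) be the Rayleigh law. Theorem. The measure $F_s$ has characteristic function $t\mapsto\Lambda_s(t)$ for $t\ge 0$, and the following hold. 1. The image of $F_{s,k}$ is closed in $\mathcal P(\mathbb R^k)$ in the weak topology and is closed under ordinary convolution $*$. 2. For every $\mathbf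 G\in\mathcal P((\mathbb R^{+})^k)$ and $\mathbf t\in(\mathbb R^{+})^k$, $\hat{\mathbf G}(\mathbf t)$ equals the characteristic function of $F_{s,k}(\mathbf G)$ at $\mathbf t$. 3. For all $\mathbf G_1,\mathbf G_2\in\mathcal P((\mathbb R^{+})^k)$, $F_{s,k}(\mathbf G_1\bigcirc_{s,k}\mathbf G_2)=F_{s,k}(\mathbf G_1)*F_{s,k}(\mathbf G_2)$, and $F_{s,k}(\delta_{\mathbf 0})=\delta_{\mathbf 0}$. 4. $F_{s,k}$ commutes with (finite) convex combinations of probability measures and with the scale changes $T_c$, $c>0$. 5. $F_{s,k}(\Sigma_{s,k})=N\bigl(\mathbf 0,\tfrac1{2(s+1)}\mathbf I\bigr)$, the centered normal law on $\mathbb R^k$ with covariance matrix $\tfrac1{2(s+1)}\mathbf I$. 6. $F_{s,k}$ is a homeomorphism of $\mathcal P((\mathbb R^{+})^k)$ onto its image. Thus it embeds the $k$-dimensional Kingman convolution algebra $(\mathcal P((\mathbb R^{+})^k),\bigcirc_{s,k})$ into the ordinary convolution algebra $(\mathcal P(\mathbb R^k),*)$. -/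

import Mathlib

open MeasureTheory ProbabilityTheory Topology
open scoped NNReal ENNReal

namespace Kingman

noncomputable section

/-! ### The Bessel kernel and the law `F_s` -/

/-- The Bessel function of the first kind `J_s(x) = ∑ₙ (-1)ⁿ (x/2)^(s+2n) / (n! Γ(s+n+1))`,
used for `x > 0`. -/
def besselJ (s x : ℝ) : ℝ :=
  ∑' n : ℕ, (-1) ^ n * (x / 2) ^ (s + 2 * n) / (n.factorial * Real.Gamma (s + n + 1))

/-- The kernel `Λ_s(x) = Γ(s+1) J_s(x) / (x/2)^s`, `x ≥ 0`, with its limiting value `Λ_s(0) = 1`. -/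
def kernel (s x : ℝ) : ℝ :=
  if x = 0 then 1 else Real.Gamma (s + 1) * besselJ s x / (x / 2) ^ s

/-- The density `Γ(s+1) / (√π Γ(s+1/2)) (1 - u²)^(s-1/2)` on `(-1, 1)`. -/
def thetaDensity (s u : ℝ) : ℝ :=
  if -1 < u ∧ u < 1 then
    Real.Gamma (s + 1) / (√Real.pi * Real.Gamma (s + 1 / 2)) * (1 - u ^ 2) ^ (s - 1 / 2)
  else 0

/-- The measure with density `thetaDensity s`; for `s = -1/2` it is the limiting law
`(δ₁ + δ₋₁) / 2`. -/
def thetaMeasure (s : ℝ) : Measure ℝ :=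
  if s = -(1 / 2) then (2⁻¹ : ℝ≥0∞) • (Measure.dirac 1 + Measure.dirac (-1))
  else volume.withDensity (fun u => ENNReal.ofReal (thetaDensity s u))

lemma lintegral_affine (g : ℝ → ℝ≥0∞) (hg : Measurable g) :
    ∫⁻ u, g u = ∫⁻ x, 2 * g (2 * x - 1) := by
  rw [← lintegral_sub_right_eq_self g (1 : ℝ)]
  conv_lhs => rw [← Real.smul_map_volume_mul_left (two_ne_zero : (2 : ℝ) ≠ 0)]
  rw [lintegral_smul_measure, lintegral_map (by fun_prop) (by fun_prop),
    lintegral_const_mul _ (by fun_prop)]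
  simp

lemma thetaDensity_affine {s : ℝ} (hs : -(1 / 2) < s) (x : ℝ) :
    2 * thetaDensity s (2 * x - 1) = betaPDFReal (s + 1 / 2) (s + 1 / 2) x := by
  unfold thetaDensity betaPDFReal
  by_cases h : 0 < x ∧ x < 1
  · rw [if_pos ⟨by linarith [h.1], by linarith [h.2]⟩, if_pos h]
    obtain ⟨h0, h1⟩ := h
    have ha : 0 < s + 1 / 2 := by linarith
    have e1 : 1 - (2 * x - 1) ^ 2 = 4 * (x * (1 - x)) := by ring
    have dup := Real.Gamma_mul_Gamma_add_half (s + 1 / 2)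
    have e2 : s + 1 / 2 + 1 / 2 = s + 1 := by ring
    rw [e2] at dup
    have hG := Real.Gamma_pos_of_pos ha
    have hG1 : 0 < Real.Gamma (s + 1) := Real.Gamma_pos_of_pos (by linarith)
    have hG2 : 0 < Real.Gamma (2 * (s + 1 / 2)) := Real.Gamma_pos_of_pos (by linarith)
    have hpi : 0 < √Real.pi := Real.sqrt_pos.2 Real.pi_pos
    have e3 : (4 : ℝ) ^ (s - 1 / 2) * 2 * (2 : ℝ) ^ (1 - 2 * (s + 1 / 2)) = 1 := by
      have h4 : (4 : ℝ) ^ (s - 1 / 2) = 2 ^ (2 * (s - 1 / 2)) := by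
        rw [Real.rpow_mul (by norm_num)]; norm_num
      have h2 : (2 : ℝ) ^ (2 * (s - 1 / 2)) * (2 : ℝ) ^ (1 - 2 * (s + 1 / 2)) = 2⁻¹ := by
        rw [← Real.rpow_add (by norm_num), ← Real.rpow_neg_one]
        congr 1; ring
      rw [h4, mul_right_comm, h2]; norm_num
    have e4 : s + 1 / 2 - 1 = s - 1 / 2 := by ring
    have e5 : s + 1 / 2 + (s + 1 / 2) = 2 * (s + 1 / 2) := by ring
    rw [e1, Real.mul_rpow (by norm_num) (by nlinarith), Real.mul_rpow h0.le (by linarith), beta,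
      e4, e5]
    have key : 2 * (Real.Gamma (s + 1) / (√Real.pi * Real.Gamma (s + 1 / 2))
        * (4 : ℝ) ^ (s - 1 / 2)) =
        1 / (Real.Gamma (s + 1 / 2) * Real.Gamma (s + 1 / 2) / Real.Gamma (2 * (s + 1 / 2))) := by
      clear e1 e2 e4 e5
      generalize Real.Gamma (2 * (s + 1 / 2)) = A at *
      generalize Real.Gamma (s + 1 / 2) = B at *
      generalize Real.Gamma (s + 1) = C at *
      generalize (4 : ℝ) ^ (s - 1 / 2) = D at *
      generalize (2 : ℝ) ^ (1 - 2 * (s + 1 / 2)) = E at *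
      field_simp
      linear_combination (2 * D) * dup + (√Real.pi * A) * e3
    linear_combination (x ^ (s - 1 / 2) * (1 - x) ^ (s - 1 / 2)) * key
  · rw [if_neg h, if_neg (fun h' => h ⟨by linarith [h'.1], by linarith [h'.2]⟩), mul_zero]

lemma measurable_thetaDensity (s : ℝ) : Measurable (thetaDensity s) :=
  Measurable.ite measurableSet_Ioo (by fun_prop) (by fun_prop)

lemma isProbabilityMeasure_thetaMeasure {s : ℝ} (hs : -(1 / 2) ≤ s) :
    IsProbabilityMeasure (thetaMeasure s) := by
  unfold thetaMeasure
  split_ifs with h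
  · constructor
    simp only [Measure.smul_apply, Measure.add_apply, measure_univ, smul_eq_mul]
    rw [one_add_one_eq_two]
    exact ENNReal.inv_mul_cancel (by norm_num) (by norm_num)
  · have hs' : -(1 / 2) < s := lt_of_le_of_ne hs (Ne.symm h)
    constructor
    rw [withDensity_apply _ MeasurableSet.univ, Measure.restrict_univ,
      lintegral_affine _ (measurable_thetaDensity s).ennreal_ofReal,
      ← lintegral_betaPDF_eq_one (α := s + 1 / 2) (β := s + 1 / 2) (by linarith) (by linarith)]
    refine lintegral_congr fun x => ?_
    rw [betaPDF, ← thetaDensity_affine hs', ENNReal.ofReal_mul (by norm_num)]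
    simp

/-- `F_s`, `s ≥ -1/2`: the symmetric probability measure on `[-1, 1]` whose characteristic function
is the kernel `Λ_s`, given explicitly. It is also the law of the variable `u` in the definition of
the Kingman convolution. -/
def thetaLaw (s : ℝ) (hs : -(1 / 2) ≤ s) : ProbabilityMeasure ℝ :=
  ⟨thetaMeasure s, isProbabilityMeasure_thetaMeasure hs⟩

/-! ### Auxiliary measurability facts -/

lemma measurable_map_section {X Y Z : Type*} [MeasurableSpace X] [MeasurableSpace Y]
    [MeasurableSpace Z] (ν : Measure Y) [SFinite ν] {f : X → Y → Z}
    (hf : Measurable (Function.uncurry f)) : Measurable fun x => ν.map (f x) := by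
  have h := (Measure.measurable_map _ hf).comp (Measurable.map_prodMk_left (ν := ν) (α := X))
  convert h using 2 with x
  simp only [Function.comp_apply]
  rw [Measure.map_map hf measurable_prodMk_left]
  rfl

lemma measurable_pi_map {X Y Z : Type*} [MeasurableSpace X] [MeasurableSpace Y]
    [MeasurableSpace Z] {k : ℕ} (ν : ProbabilityMeasure Y) {f : Fin k → X → Y → Z}
    (hf : ∀ j, Measurable (Function.uncurry (f j))) :
    Measurable fun x => Measure.pi fun j => (ν : Measure Y).map (f j x) := by
  have hf' : ∀ j x, Measurable (f j x) := fun j x => (hf j).comp measurable_prodMk_left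
  have h : (fun x => Measure.pi fun j => (ν : Measure Y).map (f j x)) =
      fun x => (Measure.pi fun _ : Fin k => (ν : Measure Y)).map fun y j => f j x (y j) := by
    funext x
    have (j : Fin k) : IsProbabilityMeasure ((ν : Measure Y).map (f j x)) :=
      Measure.isProbabilityMeasure_map (hf' j x).aemeasurable
    rw [Measure.pi_map_pi fun j => (hf' j x).aemeasurable]
  rw [h]
  refine measurable_map_section _ ?_
  refine measurable_pi_lambda _ fun j => ?_
  exact (hf j).comp (measurable_fst.prodMk ((measurable_pi_apply j).comp measurable_snd))

/-! ### The `k`-dimensional Kingman convolution -/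

/-- The length `(x² + 2uxy + y²)^(1/2)`. -/
def sideLength (u : ℝ) (x y : ℝ≥0) : ℝ≥0 :=
  Real.toNNReal √((x : ℝ) ^ 2 + 2 * u * x * y + (y : ℝ) ^ 2)

lemma measurable_sideLength {X : Type*} [MeasurableSpace X] {a b : X → ℝ≥0} (ha : Measurable a)
    (hb : Measurable b) :
    Measurable (Function.uncurry fun (p : X) (u : ℝ) => sideLength u (a p) (b p)) := by
  unfold sideLength Function.uncurry
  fun_prop

/-- `δ_x ∘_s δ_y`: the law of `(x² + 2uxy + y²)^(1/2)`, where `u` has density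
`Γ(s+1) / (√π Γ(s+1/2)) (1 - u²)^(s-1/2)` on `(-1, 1)`
(for `s = -1/2`, `u = ±1` with probability `1/2` each). -/
def pointConv (s : ℝ) (hs : -(1 / 2) ≤ s) (x y : ℝ≥0) : Measure ℝ≥0 :=
  (thetaLaw s hs : Measure ℝ).map fun u => sideLength u x y

instance (s : ℝ) (hs : -(1 / 2) ≤ s) (x y : ℝ≥0) : IsProbabilityMeasure (pointConv s hs x y) :=
  Measure.isProbabilityMeasure_map (by unfold sideLength; fun_prop)

variable {k : ℕ}

/-- `δ_x ○_{s,k} δ_y = (δ_{x₁} ∘_s δ_{y₁}) × ⋯ × (δ_{x_k} ∘_s δ_{y_k})`. -/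
def pointConvPi (s : ℝ) (hs : -(1 / 2) ≤ s) (x y : Fin k → ℝ≥0) : Measure (Fin k → ℝ≥0) :=
  Measure.pi fun j => pointConv s hs (x j) (y j)

instance (s : ℝ) (hs : -(1 / 2) ≤ s) (x y : Fin k → ℝ≥0) :
    IsProbabilityMeasure (pointConvPi s hs x y) := by
  unfold pointConvPi; infer_instance

lemma measurable_pointConvPi (s : ℝ) (hs : -(1 / 2) ≤ s) :
    Measurable fun p : (Fin k → ℝ≥0) × (Fin k → ℝ≥0) => pointConvPi s hs p.1 p.2 :=
  measurable_pi_map (thetaLaw s hs)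
    (f := fun j (p : (Fin k → ℝ≥0) × (Fin k → ℝ≥0)) u => sideLength u (p.1 j) (p.2 j))
    fun j => measurable_sideLength ((measurable_pi_apply j).comp measurable_fst)
      ((measurable_pi_apply j).comp measurable_snd)

/-- The `k`-dimensional Kingman convolution
`G₁ ○_{s,k} G₂ = ∬ (δ_x ○_{s,k} δ_y) G₁(dx) G₂(dy)`. -/
def kingmanConv (s : ℝ) (hs : -(1 / 2) ≤ s) (G₁ G₂ : ProbabilityMeasure (Fin k → ℝ≥0)) :
    ProbabilityMeasure (Fin k → ℝ≥0) :=
  ⟨((G₁ : Measure (Fin k → ℝ≥0)).prod (G₂ : Measure (Fin k → ℝ≥0))).bind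
      fun p => pointConvPi s hs p.1 p.2,
    isProbabilityMeasure_bind (measurable_pointConvPi s hs).aemeasurable
      (Filter.Eventually.of_forall fun _ => inferInstance)⟩

/-- The `k`-dimensional radial characteristic function `∫ ∏ⱼ Λ_s(tⱼ xⱼ) G(dx)`. -/
def radialCharFun (s : ℝ) (G : ProbabilityMeasure (Fin k → ℝ≥0)) (t : Fin k → ℝ≥0) : ℝ :=
  ∫ x, ∏ j, kernel s (t j * x j) ∂(G : Measure (Fin k → ℝ≥0))

/-! ### The map `F_{s,k}` -/

/-- `T_{c₁} F_s × ⋯ × T_{c_k} F_s`, as a measure on Euclidean space. -/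
def scaledProduct (s : ℝ) (hs : -(1 / 2) ≤ s) (c : Fin k → ℝ≥0) :
    Measure (EuclideanSpace ℝ (Fin k)) :=
  (Measure.pi fun j => (thetaLaw s hs : Measure ℝ).map fun u => (c j : ℝ) * u).map (WithLp.toLp 2)

instance (s : ℝ) (hs : -(1 / 2) ≤ s) (c : Fin k → ℝ≥0) :
    IsProbabilityMeasure (scaledProduct s hs c) := by
  have (j : Fin k) :
      IsProbabilityMeasure ((thetaLaw s hs : Measure ℝ).map fun u => (c j : ℝ) * u) :=
    Measure.isProbabilityMeasure_map (by fun_prop)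
  exact Measure.isProbabilityMeasure_map (by fun_prop)

lemma measurable_scaledProduct (s : ℝ) (hs : -(1 / 2) ≤ s) :
    Measurable fun c : Fin k → ℝ≥0 => scaledProduct s hs c :=
  (Measure.measurable_map _ (by fun_prop)).comp
    (measurable_pi_map (thetaLaw s hs)
      (f := fun j (c : Fin k → ℝ≥0) u => (c j : ℝ) * u) fun j => by
        unfold Function.uncurry; fun_prop)

/-- `F_{s,k}(G) = ∫ T_{c₁} F_s × ⋯ × T_{c_k} F_s G(dc)`. -/
def kingmanMap (s : ℝ) (hs : -(1 / 2) ≤ s) (G : ProbabilityMeasure (Fin k → ℝ≥0)) :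
    ProbabilityMeasure (EuclideanSpace ℝ (Fin k)) :=
  ⟨(G : Measure (Fin k → ℝ≥0)).bind fun c => scaledProduct s hs c,
    isProbabilityMeasure_bind (measurable_scaledProduct s hs).aemeasurable
      (Filter.Eventually.of_forall fun _ => inferInstance)⟩

/-! ### Operations on probability measures -/

/-- The ordinary convolution of probability measures. -/
def ordConv {E : Type*} [AddMonoid E] [MeasurableSpace E] [MeasurableAdd₂ E]
    (P Q : ProbabilityMeasure E) : ProbabilityMeasure E :=
  ⟨(P : Measure E).conv (Q : Measure E), inferInstance⟩

/-- The scale change `T_c`: the law of `c X` when `X` has law `P`. -/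
def scale {E : Type*} [MeasurableSpace E] [SMul ℝ≥0 E] [MeasurableConstSMul ℝ≥0 E] (c : ℝ≥0)
    (P : ProbabilityMeasure E) : ProbabilityMeasure E :=
  P.map (f := fun x => c • x) (measurable_const_smul c).aemeasurable

/-- The convex combination `∑ᵢ wᵢ Pᵢ`. -/
def convexComb {E : Type*} [MeasurableSpace E] {n : ℕ} (w : Fin n → ℝ≥0) (hw : ∑ i, w i = 1)
    (P : Fin n → ProbabilityMeasure E) : ProbabilityMeasure E :=
  ⟨∑ i, w i • (P i : Measure E), ⟨by
    simp only [Measure.coe_finsetSum, Finset.sum_apply, Measure.smul_apply, measure_univ]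
    simp only [ENNReal.smul_def, smul_eq_mul, mul_one]
    exact_mod_cast congrArg ((↑) : ℝ≥0 → ℝ≥0∞) hw⟩⟩

/-- The unit mass at `x`. -/
def pointMass {E : Type*} [MeasurableSpace E] (x : E) : ProbabilityMeasure E :=
  ⟨Measure.dirac x, inferInstance⟩

/-! ### The Rayleigh law -/

/-- The density `2 (s+1)^(s+1) / Γ(s+1) y^(2s+1) exp(-(s+1) y²)` on `(0, ∞)`. -/
def rayleighDensity (s y : ℝ) : ℝ :=
  2 * (s + 1) ^ (s + 1) / Real.Gamma (s + 1) * y ^ (2 * s + 1) * Real.exp (-(s + 1) * y ^ 2)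

/-- The one-dimensional Rayleigh measure `σ_s`, carried by `(0, ∞)`. -/
def rayleighMeasure (s : ℝ) : Measure ℝ≥0 :=
  ((volume.restrict (Set.Ioi (0 : ℝ))).withDensity
    fun y => ENNReal.ofReal (rayleighDensity s y)).map Real.toNNReal

lemma isProbabilityMeasure_rayleighMeasure {s : ℝ} (hs : -(1 / 2) ≤ s) :
    IsProbabilityMeasure (rayleighMeasure s) := by
  have hs1 : 0 < s + 1 := by linarith
  have hG := Real.Gamma_pos_of_pos hs1
  have hP := Real.rpow_pos_of_pos hs1 (s + 1)
  have hint : ∫ y in Set.Ioi (0 : ℝ), rayleighDensity s y = 1 := by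
    have h := integral_rpow_mul_exp_neg_mul_rpow (p := 2) (q := 2 * s + 1) (b := s + 1)
      (by norm_num) (by linarith) hs1
    have e : ∀ y : ℝ, rayleighDensity s y = (2 * (s + 1) ^ (s + 1) / Real.Gamma (s + 1)) *
        (y ^ (2 * s + 1) * Real.exp (-(s + 1) * y ^ (2 : ℝ))) := fun y => by
      rw [rayleighDensity, Real.rpow_two]; ring
    simp_rw [e]
    rw [integral_const_mul, h, show (2 * s + 1 + 1) / 2 = s + 1 by ring,
      show -(2 * s + 1 + 1) / 2 = -(s + 1) by ring, Real.rpow_neg hs1.le]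
    field_simp
  have hmeas : Measurable (rayleighDensity s) := by unfold rayleighDensity; fun_prop
  have hinteg : Integrable (rayleighDensity s) (volume.restrict (Set.Ioi (0 : ℝ))) := by
    by_contra hcon
    rw [integral_undef hcon] at hint
    exact zero_ne_one hint
  have : IsProbabilityMeasure ((volume.restrict (Set.Ioi (0 : ℝ))).withDensity
      fun y => ENNReal.ofReal (rayleighDensity s y)) := by
    constructor
    rw [withDensity_apply _ MeasurableSet.univ, Measure.restrict_univ,
      ← ofReal_integral_eq_lintegral_ofReal hinteg, hint, ENNReal.ofReal_one]
    refine (ae_restrict_iff' measurableSet_Ioi).2 (Filter.Eventually.of_forall fun y hy => ?_)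
    have hy' : (0 : ℝ) < y := hy
    simp only [rayleighDensity, Pi.zero_apply]
    positivity
  exact Measure.isProbabilityMeasure_map (by fun_prop)

/-- The `k`-dimensional Rayleigh law `Σ_{s,k} = σ_s × ⋯ × σ_s`. -/
def rayleighLaw (s : ℝ) (hs : -(1 / 2) ≤ s) (k : ℕ) : ProbabilityMeasure (Fin k → ℝ≥0) :=
  ⟨Measure.pi fun _ => rayleighMeasure s,
    have := isProbabilityMeasure_rayleighMeasure hs
    inferInstance⟩

end

end Kingman

namespace Kingman

noncomputable section

variable {k : ℕ}

/-! ### A Chu-Vandermonde identity -/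

/-! Everything is read off characteristic functions. The mixture `kingmanMap s hs G` is the law of
`(c₁u₁, …, c_k u_k)` with `c` of law `G` and independent `uⱼ` of law `F_s`. Conditioning on `c`
gives its characteristic function as the `G`-average of `∏ Λ_s(|tⱼ| cⱼ)`, once `F_s` is known to
have transform `Λ_s`. That comes from moments: the even moments of `F_s` are beta integrals, and the
characteristic function of a bounded variable is the sum of its moment series.

The homomorphism property rests on the product formula `integral_phi_sideLength`. For independent
`u, v` of law `F_s`, the variables `sideLength u x y * v` and `x u + y v` have the same moments;
comparing coefficients of `x^(2a) y^(2b)` reduces this to the Chu-Vandermonde identity. Bounded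
variables with equal moments have equal characteristic functions.

The even moments of the Rayleigh law cancel the Pochhammer factors in the series of `Λ_s`, leaving
an exponential series, hence the normal law. The same computation gives injectivity: `Λ_s(t r x)` is
symmetric in `r` and `x`, so averaging the transform of `G` over Rayleigh-distributed frequencies
yields the integrals of `exp (-∑ bⱼ xⱼ²)` against `G`. These functions span a point-separating
algebra, so they determine `G`.

Finally the map is continuous and proper. Since `F_s` is not the unit mass at 0, mass of `G` far
from the origin forces mass of its image far away, so tightness pulls back. A continuous, injective,
proper map is here a closed embedding, which gives both the closed range and the homeomorphism. -/

lemma ascPochhammer_succ_eval_left (n : ℕ) (x : ℝ) :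
    (ascPochhammer ℝ (n + 1)).eval x = x * (ascPochhammer ℝ n).eval (x + 1) := by
  simp [ascPochhammer_succ_left]

/-- Induction on `a` with `c` free: Pascal's rule pairs neighbouring terms, and in each pair the
leftover factors `(c + m) + (b - m)` add up to `c + b`, independent of `m`, leaving the sum for `a`
at `c + 1`. -/
lemma sum_choose_mul_descPochhammer_mul_ascPochhammer (a : ℕ) (b c : ℝ) :
    ∑ m ∈ Finset.range (a + 1), (a.choose m : ℝ) * (descPochhammer ℝ m).eval b *
      (ascPochhammer ℝ (a - m)).eval (c + m) = (ascPochhammer ℝ a).eval (c + b) := by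
  induction a generalizing c with
  | zero => simp
  | succ a ih =>
    rw [ascPochhammer_succ_eval_left, show c + b + 1 = (c + 1) + b by ring, ← ih (c + 1)]
    set f : ℕ → ℝ := fun m =>
      (descPochhammer ℝ m).eval b * (ascPochhammer ℝ (a + 1 - m)).eval (c + m) with hf
    have h1 : ∑ m ∈ Finset.range (a + 1 + 1), ((a + 1).choose m : ℝ) *
        (descPochhammer ℝ m).eval b * (ascPochhammer ℝ (a + 1 - m)).eval (c + m) =
        ∑ m ∈ Finset.range (a + 1), (a.choose m : ℝ) * (f m + f (m + 1)) := by
      -- Index shift; the extra top term vanishes because `a.choose (a + 1) = 0`.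
      have h2 : ∑ m ∈ Finset.range (a + 1), (a.choose m : ℝ) * f m =
          ∑ m ∈ Finset.range (a + 1), (a.choose (m + 1) : ℝ) * f (m + 1) + f 0 := by
        have := Finset.sum_range_succ' (fun m => (a.choose m : ℝ) * f m) (a + 1)
        rw [Finset.sum_range_succ] at this
        simpa using this
      simp_rw [mul_add, Finset.sum_add_distrib, h2]
      rw [Finset.sum_range_succ']
      simp only [Nat.choose_succ_succ, Nat.cast_add, add_mul, Finset.sum_add_distrib, mul_assoc]
      simp [hf]
      ring
    rw [h1, Finset.mul_sum]
    refine Finset.sum_congr rfl fun m hm => ?_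
    have hma : m ≤ a := Nat.lt_succ_iff.1 (Finset.mem_range.1 hm)
    simp only [hf]
    rw [descPochhammer_succ_eval, show a + 1 - m = (a - m) + 1 by omega,
      show a + 1 - (m + 1) = a - m by omega, ascPochhammer_succ_eval_left]
    push_cast
    rw [show c + (m + 1 : ℝ) = c + 1 + m by ring, show c + m + 1 = c + 1 + (m : ℝ) by ring]
    ring

lemma ascPochhammer_eval_add (m n : ℕ) (x : ℝ) : (ascPochhammer ℝ (m + n)).eval x =
    (ascPochhammer ℝ m).eval x * (ascPochhammer ℝ n).eval (x + m) := by
  rw [← ascPochhammer_mul]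
  simp

/-- The `2n`-th moment `(2n)! / (4ⁿ n! (s+1)ₙ)` of the law `F_s`. -/
def evenMoment (s : ℝ) (n : ℕ) : ℝ :=
  (2 * n).factorial / (4 ^ n * n.factorial * (ascPochhammer ℝ n).eval (s + 1))

lemma ascPochhammer_eval_pos {s : ℝ} (hs : -(1 / 2) ≤ s) (n : ℕ) :
    0 < (ascPochhammer ℝ n).eval (s + 1) := ascPochhammer_pos n _ (by linarith)

/-- The identity between the coefficients of `x^(2a) y^(2b)` that underlies the product formula. -/
lemma evenMoment_mul_evenMoment {s : ℝ} (hs : -(1 / 2) ≤ s) (a b : ℕ) :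
    evenMoment s (a + b) * ∑ m ∈ Finset.range (a + 1),
      (if m ≤ b then ((a + b).choose (2 * m) : ℝ) * ((a + b - 2 * m).choose (a - m) : ℝ)
        * 4 ^ m * evenMoment s m else 0) =
    ((2 * (a + b)).choose (2 * a) : ℝ) * (evenMoment s a * evenMoment s b) := by
  have hP := ascPochhammer_eval_pos hs
  have hV := sum_choose_mul_descPochhammer_mul_ascPochhammer a b (s + 1)
  -- Up to a factor free of `m`, this is Chu-Vandermonde with the natural number `b` in the falling
  -- factorial.
  have key : ∑ m ∈ Finset.range (a + 1),
      (if m ≤ b then ((a + b).choose (2 * m) : ℝ) * ((a + b - 2 * m).choose (a - m) : ℝ)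
        * 4 ^ m * evenMoment s m else 0) =
      (a + b).factorial / (a.factorial * b.factorial * (ascPochhammer ℝ a).eval (s + 1)) *
        (ascPochhammer ℝ a).eval (s + 1 + b) := by
    rw [← hV, Finset.mul_sum]
    refine Finset.sum_congr rfl fun m hm => ?_
    have hma : m ≤ a := Nat.lt_succ_iff.1 (Finset.mem_range.1 hm)
    split_ifs with hmb
    · have e1 := Nat.choose_mul_factorial_mul_factorial (show 2 * m ≤ a + b by omega)
      have e2 := Nat.choose_mul_factorial_mul_factorial (show a - m ≤ a + b - 2 * m by omega)
      rw [show a + b - 2 * m - (a - m) = b - m by omega] at e2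
      have e3 := Nat.choose_mul_factorial_mul_factorial hma
      have e4 := Nat.factorial_mul_descFactorial hmb
      have e5 := ascPochhammer_eval_add m (a - m) (s + 1)
      rw [show m + (a - m) = a by omega] at e5
      have hQ : (ascPochhammer ℝ (a - m)).eval (s + 1 + m) ≠ 0 := by
        intro h; rw [h, mul_zero] at e5; exact (hP a).ne' e5
      rw [descPochhammer_eval_eq_descFactorial, e5, evenMoment]
      have hPm := (hP m).ne'
      have E1 : ((a + b).choose (2 * m) : ℝ) * (2 * m).factorial * (a + b - 2 * m).factorial
          = (a + b).factorial := by exact_mod_cast e1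
      have E2 : ((a + b - 2 * m).choose (a - m) : ℝ) * (a - m).factorial * (b - m).factorial
          = (a + b - 2 * m).factorial := by exact_mod_cast e2
      have E3 : (a.choose m : ℝ) * m.factorial * (a - m).factorial = a.factorial := by
        exact_mod_cast e3
      have E4 : ((b - m).factorial : ℝ) * b.descFactorial m = b.factorial := by exact_mod_cast e4
      have g2 : ((a - m).factorial : ℝ) ≠ 0 := by positivity
      have g3 : ((b - m).factorial : ℝ) ≠ 0 := by positivity
      have g4 : (m.factorial : ℝ) ≠ 0 := by positivity
      have g7 : (a.choose m : ℝ) ≠ 0 := by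
        have := Nat.choose_pos hma; positivity
      have g8 : (b.descFactorial m : ℝ) ≠ 0 := by
        have := Nat.descFactorial_pos.2 hmb; positivity
      rw [← E1, ← E2, ← E3, ← E4]
      generalize (ascPochhammer ℝ (a - m)).eval (s + 1 + m) = Q at *
      generalize (ascPochhammer ℝ m).eval (s + 1) = R at *
      field_simp
    -- For `m > b` the falling factorial of `b` is zero, matching the cut-off in the sum.
    · rw [descPochhammer_eval_eq_descFactorial, Nat.descFactorial_of_lt (by omega)]
      simp
  rw [key]
  -- The right side of Chu-Vandermonde is the quotient of the Pochhammer symbols of orders `a + b`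
  -- and `b`, so it cancels against `evenMoment s (a + b)`.
  have e5 := ascPochhammer_eval_add b a (s + 1)
  rw [add_comm b a] at e5
  have hQ : (ascPochhammer ℝ a).eval (s + 1 + b) ≠ 0 := by
    intro h; rw [h, mul_zero] at e5; exact (hP _).ne' e5
  have e6 := Nat.choose_mul_factorial_mul_factorial (show 2 * a ≤ 2 * (a + b) by omega)
  rw [show 2 * (a + b) - 2 * a = 2 * b by omega] at e6
  have E6 : ((2 * (a + b)).choose (2 * a) : ℝ) * (2 * a).factorial * (2 * b).factorial =
    (2 * (a + b)).factorial := by exact_mod_cast e6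
  simp only [evenMoment]
  rw [e5, ← E6, pow_add]
  have hA := (hP a).ne'
  have hB := (hP b).ne'
  have hab : ((a + b).factorial : ℝ) ≠ 0 := by positivity
  generalize (ascPochhammer ℝ a).eval (s + 1 + b) = Q at *
  field_simp

lemma sum_range_eq_sum_even {M : Type*} [AddCommMonoid M] (N : ℕ) (f : ℕ → M)
    (hf : ∀ j, Odd j → f j = 0) :
    ∑ j ∈ Finset.range (N + 1), f j = ∑ m ∈ Finset.range (N / 2 + 1), f (2 * m) := by
  rw [← Finset.sum_image (s := Finset.range (N / 2 + 1)) (g := fun m => 2 * m) (f := f)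
    (fun x _ y _ h => by simpa using h)]
  symm
  refine Finset.sum_subset (fun j hj => ?_) fun j hj hj' => ?_
  · simp only [Finset.mem_image, Finset.mem_range] at hj ⊢
    omega
  · refine hf j (Nat.not_even_iff_odd.1 fun ⟨r, hr⟩ => hj' ?_)
    simp only [Finset.mem_image, Finset.mem_range] at hj ⊢
    exact ⟨r, by omega, by omega⟩

/-- The binomial expansion is padded with zeros to an index range independent of `m`, so that sums
over `m` and `a` can be interchanged. -/
lemma mul_pow_mul_add_pow (X Y : ℝ) {n m : ℕ} (h : 2 * m ≤ n) :
    (X * Y) ^ m * (X + Y) ^ (n - 2 * m) = ∑ a ∈ Finset.range (n + 1),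
      (if m ≤ a ∧ m ≤ n - a then ((n - 2 * m).choose (a - m) : ℝ) * X ^ a * Y ^ (n - a) else 0) := by
  rw [← Finset.sum_filter]
  have : (Finset.range (n + 1)).filter (fun a => m ≤ a ∧ m ≤ n - a) = Finset.Ico m (n - m + 1) := by
    ext a; simp only [Finset.mem_filter, Finset.mem_range, Finset.mem_Ico]; omega
  rw [this, Finset.sum_Ico_eq_sum_range, add_pow, Finset.mul_sum,
    show n - m + 1 - m = n - 2 * m + 1 by omega]
  refine Finset.sum_congr rfl fun i hi => ?_
  have : i ≤ n - 2 * m := Nat.lt_succ_iff.1 (Finset.mem_range.1 hi)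
  rw [Nat.add_sub_cancel_left, show n - (m + i) = m + (n - 2 * m - i) by omega]
  ring

/-- The moment form of the product formula. -/
lemma evenMoment_mul_sum {s : ℝ} (hs : -(1 / 2) ≤ s) (n : ℕ) (x y : ℝ) :
    evenMoment s n * ∑ m ∈ Finset.range (n / 2 + 1),
      (n.choose (2 * m) : ℝ) * ((2 * x * y) ^ (2 * m) * (x ^ 2 + y ^ 2) ^ (n - 2 * m))
        * evenMoment s m =
    ∑ a ∈ Finset.range (n + 1), ((2 * n).choose (2 * a) : ℝ) * x ^ (2 * a) * y ^ (2 * (n - a)) *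
      (evenMoment s a * evenMoment s (n - a)) := by
  have h1 : ∀ m ∈ Finset.range (n / 2 + 1),
      (n.choose (2 * m) : ℝ) * ((2 * x * y) ^ (2 * m) * (x ^ 2 + y ^ 2) ^ (n - 2 * m))
        * evenMoment s m = ∑ a ∈ Finset.range (n + 1), (if m ≤ a ∧ m ≤ n - a then
          (n.choose (2 * m) : ℝ) * ((n - 2 * m).choose (a - m) : ℝ) * 4 ^ m * evenMoment s m else 0)
          * (x ^ (2 * a) * y ^ (2 * (n - a))) := by
    intro m hm
    have hm' : 2 * m ≤ n := by have := Finset.mem_range.1 hm; omega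
    have e : (2 * x * y) ^ (2 * m) = 4 ^ m * (x ^ 2 * y ^ 2) ^ m := by
      rw [pow_mul, ← mul_pow]; congr 1; ring
    rw [e, mul_assoc (4 ^ m : ℝ), mul_pow_mul_add_pow _ _ hm', Finset.mul_sum, Finset.mul_sum,
      Finset.sum_mul]
    refine Finset.sum_congr rfl fun a _ => ?_
    split_ifs
    · rw [pow_mul, pow_mul]; ring
    · simp
  rw [Finset.sum_congr rfl h1, Finset.sum_comm, Finset.mul_sum]
  refine Finset.sum_congr rfl fun a ha => ?_
  have ha' : a ≤ n := Nat.lt_succ_iff.1 (Finset.mem_range.1 ha)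
  obtain ⟨b, rfl⟩ := Nat.exists_eq_add_of_le ha'
  rw [← Finset.sum_mul, Nat.add_sub_cancel_left]
  -- Both sums run over `m ≤ min a b`, which already implies `m ≤ (a + b) / 2`.
  have h2 : ∑ m ∈ Finset.range ((a + b) / 2 + 1), (if m ≤ a ∧ m ≤ b then
      ((a + b).choose (2 * m) : ℝ) * ((a + b - 2 * m).choose (a - m) : ℝ) * 4 ^ m * evenMoment s m
      else 0) = ∑ m ∈ Finset.range (a + 1),
      (if m ≤ b then ((a + b).choose (2 * m) : ℝ) * ((a + b - 2 * m).choose (a - m) : ℝ)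
        * 4 ^ m * evenMoment s m else 0) := by
    rw [← Finset.sum_filter, ← Finset.sum_filter]
    congr 1
    ext m; simp only [Finset.mem_filter, Finset.mem_range]; omega
  rw [h2]
  linear_combination (x ^ (2 * a) * y ^ (2 * b)) * evenMoment_mul_evenMoment hs a b

/-! ### Moments of `F_s` -/

lemma Gamma_add_natCast {x : ℝ} (hx : 0 < x) (n : ℕ) :
    Real.Gamma (x + n) = (ascPochhammer ℝ n).eval x * Real.Gamma x := by
  induction n with
  | zero => simp
  | succ n ih =>
    rw [Nat.cast_succ, ← add_assoc, Real.Gamma_add_one (by positivity), ih, ascPochhammer_succ_eval]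
    ring

/-- Rewrites `evenMoment s n` as a ratio of Pochhammer symbols at `1/2` and `s + 1`, the form in
which a beta integral produces it. -/
lemma factorial_two_mul_eq_ascPochhammer (n : ℕ) :
    ((2 * n).factorial : ℝ) = 4 ^ n * n.factorial * (ascPochhammer ℝ n).eval (1 / 2) := by
  induction n with
  | zero => simp
  | succ n ih =>
    rw [show 2 * (n + 1) = 2 * n + 1 + 1 by ring, Nat.factorial_succ, Nat.factorial_succ,
      Nat.factorial_succ, ascPochhammer_succ_eval]
    push_cast
    rw [ih]
    ring

lemma integral_betaPDFReal {α β : ℝ} (hα : 0 < α) (hβ : 0 < β) :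
    ∫ x in Set.Ioi (0 : ℝ), betaPDFReal α β x = 1 := by
  rw [setIntegral_eq_integral_of_forall_compl_eq_zero (fun x hx => ?_),
    integral_eq_lintegral_of_nonneg_ae (Filter.Eventually.of_forall fun x => ?_)
      (stronglyMeasurable_betaPDFReal α β).aestronglyMeasurable]
  · have := lintegral_betaPDF_eq_one hα hβ
    simp only [betaPDF] at this
    rw [this]; simp
  · by_cases h : 0 < x ∧ x < 1
    · exact (betaPDFReal_pos h.1 h.2 hα hβ).le
    · simp [betaPDFReal, h]
  · rw [betaPDFReal, if_neg fun h => hx h.1]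

lemma thetaDensity_nonneg {s : ℝ} (hs : -(1 / 2) < s) (u : ℝ) : 0 ≤ thetaDensity s u := by
  unfold thetaDensity
  split_ifs with h
  · have : 0 ≤ 1 - u ^ 2 := by nlinarith [h.1, h.2]
    have := Real.Gamma_pos_of_pos (show 0 < s + 1 by linarith)
    have := Real.Gamma_pos_of_pos (show 0 < s + 1 / 2 by linarith)
    positivity
  · exact le_rfl

lemma integral_thetaMeasure {s : ℝ} (hs : -(1 / 2) < s) (g : ℝ → ℝ) :
    ∫ u, g u ∂thetaMeasure s = ∫ u, thetaDensity s u * g u := by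
  rw [thetaMeasure, if_neg hs.ne', integral_withDensity_eq_integral_toReal_smul
    (measurable_thetaDensity s).ennreal_ofReal (by simp)]
  simp [ENNReal.toReal_ofReal (thetaDensity_nonneg hs _)]

lemma integral_thetaMeasure_neg_half (g : ℝ → ℝ) :
    ∫ u, g u ∂thetaMeasure (-(1 / 2)) = (g 1 + g (-1)) / 2 := by
  rw [thetaMeasure, if_pos rfl, integral_smul_measure, integral_add_measure]
  · simp; ring
  · exact integrable_dirac (by simp)
  · exact integrable_dirac (by simp)

lemma integral_thetaMeasure_comp_neg {s : ℝ} (hs : -(1 / 2) ≤ s) (g : ℝ → ℝ) :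
    ∫ u, g (-u) ∂thetaMeasure s = ∫ u, g u ∂thetaMeasure s := by
  rcases hs.eq_or_lt with rfl | hs
  · rw [integral_thetaMeasure_neg_half, integral_thetaMeasure_neg_half, neg_neg, add_comm]
  · rw [integral_thetaMeasure hs, integral_thetaMeasure hs, ← integral_neg_eq_self]
    refine integral_congr_ae (Filter.Eventually.of_forall fun u => ?_)
    simp only [thetaDensity, neg_neg]
    rw [neg_sq]
    congr 1
    refine if_congr ⟨fun h => ⟨?_, ?_⟩, fun h => ⟨?_, ?_⟩⟩ rfl rfl <;> linarith [h.1, h.2]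

lemma ae_abs_le_one_thetaMeasure (s : ℝ) : ∀ᵐ u ∂thetaMeasure s, |u| ≤ 1 := by
  unfold thetaMeasure
  have hm : MeasurableSet {u : ℝ | |u| ≤ 1} := measurableSet_le (by fun_prop) (by fun_prop)
  split_ifs with h
  · refine Measure.ae_smul_measure ?_ _
    rw [ae_add_measure_iff, ae_dirac_iff hm, ae_dirac_iff hm]
    simp
  · rw [ae_withDensity_iff (measurable_thetaDensity s).ennreal_ofReal]
    refine Filter.Eventually.of_forall fun u hu => ?_
    by_contra hc
    refine hu ?_
    rw [thetaDensity, if_neg fun h => hc (abs_le.2 ⟨h.1.le, h.2.le⟩), ENNReal.ofReal_zero]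

lemma integral_odd_pow_thetaMeasure {s : ℝ} (hs : -(1 / 2) ≤ s) {n : ℕ} (hn : Odd n) :
    ∫ u, u ^ n ∂thetaMeasure s = 0 := by
  have := integral_thetaMeasure_comp_neg hs fun u => u ^ n
  simp only [hn.neg_pow, integral_neg] at this
  linarith

/-- In the degenerate case `s = -1/2` both sides are 1. Otherwise evenness folds the integral onto
the half-line and `y = u²` turns it into a multiple of the `Beta(n + 1/2, s + 1/2)` density. -/
lemma integral_even_pow_thetaMeasure {s : ℝ} (hs : -(1 / 2) ≤ s) (n : ℕ) :
    ∫ u, u ^ (2 * n) ∂thetaMeasure s = evenMoment s n := by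
  have h4 : (4 : ℝ) ^ n ≠ 0 := by positivity
  have hf : (n.factorial : ℝ) ≠ 0 := by positivity
  have hP := (ascPochhammer_eval_pos hs n).ne'
  rw [evenMoment, factorial_two_mul_eq_ascPochhammer]
  rcases hs.eq_or_lt with rfl | hs
  · rw [integral_thetaMeasure_neg_half]
    have e : -(1 / 2) + 1 = (1 / 2 : ℝ) := by norm_num
    rw [e] at hP ⊢
    rw [div_self (by positivity), (even_two_mul n).neg_pow, one_pow]
    norm_num
  · have hG1 := Gamma_add_natCast (show 0 < s + 1 by linarith) n
    have hG2 := Gamma_add_natCast (show (0 : ℝ) < 1 / 2 by norm_num) n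
    have h1 := Real.Gamma_pos_of_pos (show 0 < s + 1 by linarith)
    have h2 := Real.Gamma_pos_of_pos (show 0 < s + 1 / 2 by linarith)
    rw [Real.Gamma_one_half_eq] at hG2
    have hn : (0 : ℝ) < n + 1 / 2 := by positivity
    set K := Real.Gamma (s + 1) / (√Real.pi * Real.Gamma (s + 1 / 2)) *
      beta (n + 1 / 2) (s + 1 / 2) with hK
    have hb := beta_pos hn (show 0 < s + 1 / 2 by linarith)
    rw [integral_thetaMeasure hs]
    calc ∫ u, thetaDensity s u * u ^ (2 * n)
        = ∫ u, (fun v => thetaDensity s v * v ^ (2 * n)) |u| := by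
          refine integral_congr_ae (Filter.Eventually.of_forall fun u => ?_)
          simp only [thetaDensity, sq_abs, pow_mul]
          congr 1
          refine if_congr ?_ rfl rfl
          rw [← abs_lt]
          exact ⟨fun h => ⟨by linarith [abs_nonneg u], h⟩, fun h => h.2⟩
      _ = 2 * ∫ u in Set.Ioi (0 : ℝ), thetaDensity s u * u ^ (2 * n) :=
          integral_comp_abs (f := fun v => thetaDensity s v * v ^ (2 * n))
      -- The factor `2 * u ^ (2 - 1)` is the Jacobian of `y = u²`, in the shape expected by the
      -- substitution rule.
      _ = 2 * ∫ u in Set.Ioi (0 : ℝ), ((2 : ℝ) * u ^ ((2 : ℝ) - 1)) •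
            (fun y => K / 2 * betaPDFReal (n + 1 / 2) (s + 1 / 2) y) (u ^ (2 : ℝ)) := by
          congr 1
          refine setIntegral_congr_fun measurableSet_Ioi fun u hu => ?_
          have hu : 0 < u := hu
          simp only [thetaDensity, betaPDFReal, Real.rpow_two, smul_eq_mul]
          by_cases h : u < 1
          · rw [if_pos ⟨by linarith, h⟩, if_pos ⟨by positivity, by nlinarith⟩,
              show (2 : ℝ) - 1 = 1 by norm_num, Real.rpow_one, ← Real.rpow_natCast_mul hu.le, hK,
              show ((2 : ℕ) : ℝ) * (n + 1 / 2 - 1) = (2 * n : ℕ) - 1 by push_cast; ring,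
              Real.rpow_sub_one hu.ne', Real.rpow_natCast,
              show s + 1 / 2 - 1 = s - 1 / 2 by ring]
            generalize beta (n + 1 / 2) (s + 1 / 2) = B at hb ⊢
            generalize Real.Gamma (s + 1 / 2) = D at h2 ⊢
            generalize (1 - u ^ 2) ^ (s - 1 / 2) = W
            field_simp
          · rw [if_neg fun h' => h h'.2, if_neg fun h' => h (by nlinarith [h'.2])]
            simp
      _ = K := by
          rw [integral_comp_rpow_Ioi_of_pos (g := fun y => K / 2 *
            betaPDFReal (n + 1 / 2) (s + 1 / 2) y) two_pos, integral_const_mul,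
            integral_betaPDFReal hn (by linarith)]
          ring
      _ = _ := by
          rw [hK, beta, show (n : ℝ) + 1 / 2 + (s + 1 / 2) = s + 1 + n by ring,
            add_comm (n : ℝ) (1 / 2), hG1, hG2]
          have := Real.sqrt_pos.2 Real.pi_pos
          generalize Real.Gamma (s + 1 / 2) = D at h2 ⊢
          field_simp

/-! ### Characteristic functions of bounded random variables -/

/-- Boundedness dominates the exponential series by that of `exp (|t| C)`, so it may be integrated
termwise. The characteristic function of a bounded variable therefore depends only on its moments.
-/
lemma hasSum_integral_exp_mul_I {Ω : Type*} [MeasurableSpace Ω] (μ : Measure Ω)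
    [IsProbabilityMeasure μ] {X : Ω → ℝ} (hX : AEMeasurable X μ) {C : ℝ}
    (hC : ∀ᵐ ω ∂μ, |X ω| ≤ C) (t : ℝ) :
    HasSum (fun n : ℕ => (Complex.I * t) ^ n / n.factorial * ((∫ ω, X ω ^ n ∂μ : ℝ) : ℂ))
      (∫ ω, Complex.exp (t * X ω * Complex.I) ∂μ) := by
  have hC0 : 0 ≤ C := by
    obtain ⟨ω, hω⟩ := hC.exists
    exact (abs_nonneg _).trans hω
  have hb : ∀ n : ℕ, ∀ᵐ ω ∂μ, ‖(Complex.I * t) ^ n / n.factorial * ((X ω ^ n : ℝ) : ℂ)‖ ≤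
      (|t| * C) ^ n / n.factorial := by
    intro n
    filter_upwards [hC] with ω hω
    simp only [Complex.norm_mul, Complex.norm_div, norm_pow, Complex.norm_I, Complex.norm_real,
      Complex.norm_natCast, Real.norm_eq_abs, one_mul, mul_pow, one_pow]
    rw [div_mul_eq_mul_div]
    gcongr
  have hm : ∀ n : ℕ, AEStronglyMeasurable
      (fun ω => (Complex.I * t) ^ n / n.factorial * ((X ω ^ n : ℝ) : ℂ)) μ := fun n =>
    (((Complex.measurable_ofReal.comp_aemeasurable
      (hX.pow_const n))).const_mul _).aestronglyMeasurable
  have hint : ∀ n : ℕ, Integrable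
      (fun ω => (Complex.I * t) ^ n / n.factorial * ((X ω ^ n : ℝ) : ℂ)) μ := fun n =>
    Integrable.of_bound (hm n) _ (hb n)
  have h := hasSum_integral_of_summable_integral_norm hint
    ((Real.summable_pow_div_factorial (|t| * C)).of_nonneg_of_le
      (fun n => integral_nonneg fun _ => norm_nonneg _) fun n => by
        refine (integral_mono_ae (hint n).norm (integrable_const _) (hb n)).trans ?_
        simp)
  have e1 : (fun n : ℕ => (Complex.I * t) ^ n / n.factorial * ((∫ ω, X ω ^ n ∂μ : ℝ) : ℂ)) =
      fun n : ℕ => ∫ ω, (Complex.I * t) ^ n / n.factorial * ((X ω ^ n : ℝ) : ℂ) ∂μ := by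
    funext n
    rw [integral_const_mul, integral_complex_ofReal]
  have e2 : ∫ ω, Complex.exp (t * X ω * Complex.I) ∂μ =
      ∫ ω, ∑' n : ℕ, (Complex.I * t) ^ n / n.factorial * ((X ω ^ n : ℝ) : ℂ) ∂μ := by
    refine integral_congr_ae (Filter.Eventually.of_forall fun ω => ?_)
    simp only
    rw [Complex.exp_eq_exp_ℂ, NormedSpace.exp_eq_tsum_div]
    refine tsum_congr fun n => ?_
    push_cast
    rw [div_mul_eq_mul_div, ← mul_pow]
    ring_nf
  rw [e1, e2]
  exact h

/-! ### The kernel as a power series -/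

/-- The real power `(x/2)^s` and the factor `Γ(s+1)` cancel termwise, leaving even integer powers;
at `x = 0` only the constant term survives, in agreement with the convention there. -/
lemma kernel_eq_tsum {s : ℝ} (hs : -(1 / 2) ≤ s) {x : ℝ} (hx : 0 ≤ x) :
    kernel s x = ∑' n : ℕ, (-1) ^ n * (x / 2) ^ (2 * n) /
      (n.factorial * (ascPochhammer ℝ n).eval (s + 1)) := by
  rcases hx.eq_or_lt with rfl | hx
  · rw [kernel, if_pos rfl, tsum_eq_single 0]
    · simp
    · intro n hn
      simp [hn]
  · rw [kernel, if_neg hx.ne', besselJ, ← tsum_mul_left, div_eq_mul_inv, ← tsum_mul_right]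
    refine tsum_congr fun n => ?_
    have hx2 : 0 < x / 2 := by positivity
    have h1 := Real.Gamma_pos_of_pos (show 0 < s + 1 by linarith)
    rw [Real.rpow_add hx2, show s + n + 1 = s + 1 + n by ring,
      Gamma_add_natCast (by linarith), show (2 : ℝ) * n = (2 * n : ℕ) by push_cast; ring,
      Real.rpow_natCast]
    have h2 := ascPochhammer_eval_pos hs n
    have h3 : 0 < (x / 2) ^ s := by positivity
    field_simp

/-- The characteristic function of `F_s`, as a real function on the line. -/
def phi (s t : ℝ) : ℝ := kernel s |t|

lemma phi_eq_kernel (s : ℝ) {t : ℝ} (ht : 0 ≤ t) : phi s t = kernel s t := by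
  rw [phi, abs_of_nonneg ht]

lemma hasSum_phi_complex {s : ℝ} (hs : -(1 / 2) ≤ s) (t : ℝ) :
    HasSum (fun n : ℕ => (((-1) ^ n * (t / 2) ^ (2 * n) /
      (n.factorial * (ascPochhammer ℝ n).eval (s + 1)) : ℝ) : ℂ))
      (∫ u, Complex.exp (t * u * Complex.I) ∂thetaMeasure s) := by
  have := isProbabilityMeasure_thetaMeasure hs
  have h := hasSum_integral_exp_mul_I (thetaMeasure s) (X := fun u => u) aemeasurable_id
    (ae_abs_le_one_thetaMeasure s) t
  have hinj : Function.Injective fun n : ℕ => 2 * n := fun a b h => by simpa using h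
  -- Odd moments vanish, so the moment series is supported on the range of `n ↦ 2 * n`.
  rw [← hinj.hasSum_iff] at h
  · convert h using 2 with n
    simp only [Function.comp_apply]
    rw [integral_even_pow_thetaMeasure hs, evenMoment, pow_mul (Complex.I * t), mul_pow Complex.I,
      Complex.I_sq, pow_mul (t / 2)]
    push_cast
    have h2 : (((2 * n).factorial : ℕ) : ℂ) ≠ 0 := by
      exact_mod_cast (Nat.factorial_pos _).ne'
    rw [show ((t : ℂ) / 2) ^ 2 = t ^ 2 / 4 by ring, div_pow, mul_pow]
    field_simp
  · intro n hn
    rw [integral_odd_pow_thetaMeasure hs, Complex.ofReal_zero, mul_zero]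
    refine Nat.not_even_iff_odd.1 fun ⟨r, hr⟩ => hn ⟨r, ?_⟩
    simp only; omega

lemma hasSum_phi {s : ℝ} (hs : -(1 / 2) ≤ s) (t : ℝ) :
    HasSum (fun n : ℕ => (-1) ^ n * (t / 2) ^ (2 * n) /
      (n.factorial * (ascPochhammer ℝ n).eval (s + 1))) (phi s t) := by
  have h := (hasSum_phi_complex hs t).summable
  rw [phi, kernel_eq_tsum hs (abs_nonneg t)]
  simp only [pow_mul, div_pow, sq_abs] at h ⊢
  exact (Complex.summable_ofReal.1 h).hasSum

lemma integral_exp_thetaMeasure {s : ℝ} (hs : -(1 / 2) ≤ s) (t : ℝ) :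
    ∫ u, Complex.exp (t * u * Complex.I) ∂thetaMeasure s = (phi s t : ℂ) :=
  (hasSum_phi_complex hs t).unique (Complex.hasSum_ofReal.2 (hasSum_phi hs t))

lemma charFun_thetaMeasure {s : ℝ} (hs : -(1 / 2) ≤ s) (t : ℝ) :
    charFun (thetaMeasure s) t = (phi s t : ℂ) := by
  rw [charFun_apply_real, integral_exp_thetaMeasure hs]

lemma abs_phi_le_one {s : ℝ} (hs : -(1 / 2) ≤ s) (t : ℝ) : |phi s t| ≤ 1 := by
  have := isProbabilityMeasure_thetaMeasure hs
  have h := norm_charFun_le_one (μ := thetaMeasure s) t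
  rwa [charFun_thetaMeasure hs, Complex.norm_real] at h

lemma measurable_phi {s : ℝ} (hs : -(1 / 2) ≤ s) : Measurable (phi s) := by
  have := isProbabilityMeasure_thetaMeasure hs
  have h : phi s = fun t => (charFun (thetaMeasure s) t).re := by
    funext t; rw [charFun_thetaMeasure hs, Complex.ofReal_re]
  rw [h]
  exact Complex.measurable_re.comp measurable_charFun

/-! ### The product formula -/

lemma integrable_pow_thetaMeasure {s : ℝ} (hs : -(1 / 2) ≤ s) (n : ℕ) :
    Integrable (fun u : ℝ => u ^ n) (thetaMeasure s) := by
  have := isProbabilityMeasure_thetaMeasure hs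
  refine Integrable.of_bound (by fun_prop) 1 ?_
  filter_upwards [ae_abs_le_one_thetaMeasure s] with u hu
  rw [norm_pow, Real.norm_eq_abs]
  exact pow_le_one₀ (abs_nonneg u) hu

lemma integral_add_mul_pow_thetaMeasure {s : ℝ} (hs : -(1 / 2) ≤ s) (n : ℕ) (A B : ℝ) :
    ∫ u, (B * u + A) ^ n ∂thetaMeasure s = ∑ m ∈ Finset.range (n / 2 + 1),
      (n.choose (2 * m) : ℝ) * (B ^ (2 * m) * A ^ (n - 2 * m)) * evenMoment s m := by
  simp_rw [add_pow, mul_pow]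
  rw [integral_finsetSum _ fun j _ => ((((integrable_pow_thetaMeasure hs j).const_mul _).mul_const
    _).mul_const _)]
  simp_rw [integral_mul_const, integral_const_mul]
  rw [sum_range_eq_sum_even]
  · refine Finset.sum_congr rfl fun m _ => ?_
    rw [integral_even_pow_thetaMeasure hs]
    ring
  · intro j hj
    rw [integral_odd_pow_thetaMeasure hs hj]
    ring

lemma integral_prod_add_pow_thetaMeasure {s : ℝ} (hs : -(1 / 2) ≤ s) (N : ℕ) (x y : ℝ) :
    ∫ p : ℝ × ℝ, (x * p.1 + y * p.2) ^ N ∂(thetaMeasure s).prod (thetaMeasure s) =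
      ∑ j ∈ Finset.range (N + 1), (N.choose j : ℝ) * x ^ j * y ^ (N - j) *
        ((∫ u, u ^ j ∂thetaMeasure s) * ∫ u, u ^ (N - j) ∂thetaMeasure s) := by
  have := isProbabilityMeasure_thetaMeasure hs
  simp_rw [add_pow, mul_pow]
  rw [integral_finsetSum]
  · refine Finset.sum_congr rfl fun j _ => ?_
    rw [← integral_prod_mul, ← integral_const_mul]
    refine integral_congr_ae (Filter.Eventually.of_forall fun p => ?_)
    simp only
    ring
  · intro j _
    have h := ((integrable_pow_thetaMeasure hs j).mul_prod
      (integrable_pow_thetaMeasure hs (N - j))).const_mul ((N.choose j : ℝ) * x ^ j * y ^ (N - j))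
    refine h.congr (Filter.Eventually.of_forall fun p => ?_)
    simp only
    ring

lemma sq_add_nonneg {u : ℝ} (hu : |u| ≤ 1) (x y : ℝ) : 0 ≤ x ^ 2 + 2 * u * x * y + y ^ 2 := by
  obtain ⟨h1, h2⟩ := abs_le.1 hu
  nlinarith [mul_nonneg (sub_nonneg.2 h2) (sq_nonneg (x - y)),
    mul_nonneg (neg_le_iff_add_nonneg.1 h1) (sq_nonneg (x + y))]

lemma sideLength_sq {u : ℝ} (hu : |u| ≤ 1) (x y : ℝ≥0) :
    (sideLength u x y : ℝ) ^ 2 = (x : ℝ) ^ 2 + 2 * u * x * y + (y : ℝ) ^ 2 := by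
  rw [sideLength, Real.coe_toNNReal _ (Real.sqrt_nonneg _), Real.sq_sqrt (sq_add_nonneg hu _ _)]

lemma sideLength_le {u : ℝ} (hu : |u| ≤ 1) (x y : ℝ≥0) : (sideLength u x y : ℝ) ≤ x + y := by
  refine abs_le_of_sq_le_sq' ?_ (by positivity) |>.2
  rw [sideLength_sq hu]
  have := (abs_le.1 hu).2
  have h : (0 : ℝ) ≤ x * y := by positivity
  nlinarith

lemma measurable_sideLength_left (x y : ℝ≥0) : Measurable fun u => sideLength u x y := by
  unfold sideLength; fun_prop

/-- The heart of the product formula. For odd `N` both sides vanish by symmetry. For even `N` the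
square of `sideLength` is affine in the first variable, so the left side is polynomial in the
moments of `F_s` and `evenMoment_mul_sum` applies. -/
lemma integral_prod_mul_sideLength_pow {s : ℝ} (hs : -(1 / 2) ≤ s) (N : ℕ) (x y : ℝ≥0) :
    ∫ p : ℝ × ℝ, ((sideLength p.1 x y : ℝ) * p.2) ^ N ∂(thetaMeasure s).prod (thetaMeasure s) =
      ∫ p : ℝ × ℝ, (x * p.1 + y * p.2) ^ N ∂(thetaMeasure s).prod (thetaMeasure s) := by
  have := isProbabilityMeasure_thetaMeasure hs
  rw [integral_prod_add_pow_thetaMeasure hs]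
  simp_rw [mul_pow]
  rw [integral_prod_mul (fun u => (sideLength u x y : ℝ) ^ N) fun v => v ^ N]
  rcases Nat.even_or_odd N with ⟨n, rfl⟩ | hN
  · rw [← two_mul, integral_even_pow_thetaMeasure hs, sum_range_eq_sum_even,
      Nat.mul_div_cancel_left _ two_pos]
    · have h1 : ∫ u, (sideLength u x y : ℝ) ^ (2 * n) ∂thetaMeasure s =
          ∫ u, ((2 * x * y) * u + ((x : ℝ) ^ 2 + (y : ℝ) ^ 2)) ^ n ∂thetaMeasure s := by
        refine integral_congr_ae ?_
        filter_upwards [ae_abs_le_one_thetaMeasure s] with u hu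
        rw [pow_mul, sideLength_sq hu]
        ring
      rw [h1, integral_add_mul_pow_thetaMeasure hs, mul_comm, evenMoment_mul_sum hs]
      refine Finset.sum_congr rfl fun a _ => ?_
      rw [← Nat.mul_sub, integral_even_pow_thetaMeasure hs, integral_even_pow_thetaMeasure hs]
    · intro j hj
      rw [integral_odd_pow_thetaMeasure hs hj]
      ring
  · rw [integral_odd_pow_thetaMeasure hs hN, mul_zero]
    symm
    refine Finset.sum_eq_zero fun j hj => ?_
    have hj' : j ≤ N := Nat.lt_succ_iff.1 (Finset.mem_range.1 hj)
    rcases Nat.even_or_odd j with he | ho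
    · rw [integral_odd_pow_thetaMeasure hs (Nat.Odd.sub_even hj' hN he)]
      ring
    · rw [integral_odd_pow_thetaMeasure hs ho]
      ring

lemma integrable_exp_mul_I {Ω : Type*} [MeasurableSpace Ω] (μ : Measure Ω)
    [IsFiniteMeasure μ] {X : Ω → ℝ} (hX : Measurable X) :
    Integrable (fun ω => Complex.exp (X ω * Complex.I)) μ := by
  refine Integrable.of_bound (by fun_prop) 1 (Filter.Eventually.of_forall fun ω => ?_)
  rw [Complex.norm_exp_ofReal_mul_I]

/-- The product formula `∫ Λ_s(t z) (δ_x ∘_s δ_y)(dz) = Λ_s(t x) Λ_s(t y)`. -/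
lemma integral_phi_sideLength {s : ℝ} (hs : -(1 / 2) ≤ s) (t : ℝ) (x y : ℝ≥0) :
    ∫ u, phi s (t * sideLength u x y) ∂thetaMeasure s = phi s (t * x) * phi s (t * y) := by
  have := isProbabilityMeasure_thetaMeasure hs
  have hae : ∀ᵐ p ∂(thetaMeasure s).prod (thetaMeasure s), |p.1| ≤ 1 ∧ |p.2| ≤ 1 := by
    have h1 := Measure.quasiMeasurePreserving_fst (μ := thetaMeasure s) (ν := thetaMeasure s)
      |>.ae (ae_abs_le_one_thetaMeasure s)
    have h2 := Measure.quasiMeasurePreserving_snd (μ := thetaMeasure s) (ν := thetaMeasure s)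
      |>.ae (ae_abs_le_one_thetaMeasure s)
    exact h1.and h2
  have hmL : Measurable fun p : ℝ × ℝ => (sideLength p.1 x y : ℝ) * p.2 :=
    ((measurable_sideLength_left x y).comp measurable_fst).coe_nnreal_real.mul measurable_snd
  have hL := hasSum_integral_exp_mul_I ((thetaMeasure s).prod (thetaMeasure s))
    (X := fun p => (sideLength p.1 x y : ℝ) * p.2) hmL.aemeasurable (C := x + y) (by
      filter_upwards [hae] with p hp
      rw [abs_mul, NNReal.abs_eq]
      calc (sideLength p.1 x y : ℝ) * |p.2| ≤ (x + y) * 1 := by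
            gcongr
            · exact sideLength_le hp.1 x y
            · exact hp.2
        _ = _ := mul_one _) t
  have hR := hasSum_integral_exp_mul_I ((thetaMeasure s).prod (thetaMeasure s))
    (X := fun p => (x : ℝ) * p.1 + y * p.2) (by fun_prop) (C := x + y) (by
      filter_upwards [hae] with p hp
      refine (abs_add_le _ _).trans ?_
      rw [abs_mul, abs_mul, NNReal.abs_eq, NNReal.abs_eq]
      calc (x : ℝ) * |p.1| + y * |p.2| ≤ x * 1 + y * 1 := by
            gcongr
            · exact hp.1
            · exact hp.2
        _ = _ := by ring) t
  simp_rw [integral_prod_mul_sideLength_pow hs] at hL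
  -- Equal moments make the two series identical, so the two characteristic functions agree; below,
  -- Fubini evaluates each in terms of `phi`.
  have h := hL.unique hR
  have e1 : ∫ p : ℝ × ℝ, Complex.exp (t * ((sideLength p.1 x y * p.2 : ℝ) : ℂ) * Complex.I)
      ∂(thetaMeasure s).prod (thetaMeasure s) =
      ((∫ u, phi s (t * sideLength u x y) ∂thetaMeasure s : ℝ) : ℂ) := by
    rw [integral_prod, ← integral_complex_ofReal]
    · refine integral_congr_ae (Filter.Eventually.of_forall fun u => ?_)
      simp only
      rw [← integral_exp_thetaMeasure hs]
      refine integral_congr_ae (Filter.Eventually.of_forall fun v => ?_)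
      simp only
      push_cast
      ring_nf
    · have := integrable_exp_mul_I ((thetaMeasure s).prod (thetaMeasure s)) (hmL.const_mul t)
      simpa using this
  have e2 : ∫ p : ℝ × ℝ, Complex.exp (t * ((x * p.1 + y * p.2 : ℝ) : ℂ) * Complex.I)
      ∂(thetaMeasure s).prod (thetaMeasure s) = (phi s (t * x) : ℂ) * phi s (t * y) := by
    rw [← integral_exp_thetaMeasure hs, ← integral_exp_thetaMeasure hs, ← integral_prod_mul]
    refine integral_congr_ae (Filter.Eventually.of_forall fun p => ?_)
    simp only
    rw [← Complex.exp_add]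
    push_cast
    ring_nf
  rw [e1, e2] at h
  exact_mod_cast h

/-! ### The Rayleigh transform -/

lemma rayleighDensity_nonneg {s : ℝ} (hs : -(1 / 2) ≤ s) {y : ℝ} (hy : 0 ≤ y) :
    0 ≤ rayleighDensity s y := by
  have hs1 : 0 < s + 1 := by linarith
  have := Real.Gamma_pos_of_pos hs1
  unfold rayleighDensity
  positivity

lemma measurable_rayleighDensity (s : ℝ) : Measurable (rayleighDensity s) := by
  unfold rayleighDensity; fun_prop

lemma integral_rayleighMeasure {s : ℝ} (hs : -(1 / 2) ≤ s) {g : ℝ → ℝ} (hg : Measurable g) :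
    ∫ r, g r ∂rayleighMeasure s = ∫ y in Set.Ioi (0 : ℝ), rayleighDensity s y * g y := by
  have hg' : Measurable fun r : ℝ≥0 => g r := hg.comp measurable_coe_nnreal_real
  rw [rayleighMeasure, integral_map (by fun_prop) hg'.aestronglyMeasurable,
    integral_withDensity_eq_integral_toReal_smul
    (measurable_rayleighDensity s).ennreal_ofReal (by simp)]
  refine setIntegral_congr_fun measurableSet_Ioi fun y hy => ?_
  have hy : 0 < y := hy
  simp only [smul_eq_mul]
  rw [ENNReal.toReal_ofReal (rayleighDensity_nonneg hs hy.le), Real.coe_toNNReal _ hy.le]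

lemma integral_pow_rayleighMeasure {s : ℝ} (hs : -(1 / 2) ≤ s) (n : ℕ) :
    ∫ r, (r : ℝ) ^ (2 * n) ∂rayleighMeasure s =
      (ascPochhammer ℝ n).eval (s + 1) / (s + 1) ^ n := by
  have hs1 : 0 < s + 1 := by linarith
  rw [integral_rayleighMeasure hs (g := fun y => y ^ (2 * n)) (by fun_prop)]
  have h := integral_rpow_mul_exp_neg_mul_rpow (p := 2) (q := 2 * s + 1 + 2 * n) (b := s + 1)
      (by norm_num) (by have : (0 : ℝ) ≤ n := by positivity
                        linarith) hs1
  have e : ∀ y ∈ Set.Ioi (0 : ℝ), rayleighDensity s y * y ^ (2 * n) =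
      (2 * (s + 1) ^ (s + 1) / Real.Gamma (s + 1)) *
        (y ^ (2 * s + 1 + 2 * n) * Real.exp (-(s + 1) * y ^ (2 : ℝ))) := fun y hy => by
    have hy : 0 < y := hy
    rw [rayleighDensity, Real.rpow_two, Real.rpow_add hy (2 * s + 1),
      show (2 : ℝ) * n = (2 * n : ℕ) by push_cast; ring, Real.rpow_natCast]
    ring
  rw [setIntegral_congr_fun measurableSet_Ioi e, integral_const_mul, h,
    show (2 * s + 1 + 2 * n + 1) / 2 = s + 1 + n by ring,
    show -(2 * s + 1 + 2 * n + 1) / 2 = -(s + 1) - n by ring, Real.rpow_sub hs1,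
    Real.rpow_neg hs1.le, Real.rpow_natCast, Gamma_add_natCast hs1]
  have h1 := Real.Gamma_pos_of_pos hs1
  have h2 : 0 < (s + 1) ^ (s + 1) := by positivity
  field_simp

lemma integrable_pow_rayleighMeasure {s : ℝ} (hs : -(1 / 2) ≤ s) (n : ℕ) :
    Integrable (fun r : ℝ≥0 => (r : ℝ) ^ (2 * n)) (rayleighMeasure s) := by
  by_contra h
  have h1 := integral_pow_rayleighMeasure hs n
  -- A non-integrable function has integral 0 by convention, whereas the computed moment is
  -- positive.
  rw [integral_undef h] at h1
  have h2 := ascPochhammer_eval_pos hs n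
  have hs1 : 0 < s + 1 := by linarith
  have : 0 < (ascPochhammer ℝ n).eval (s + 1) / (s + 1) ^ n := by positivity
  linarith

/-- The moment of order `2n` cancels the Pochhammer symbol in the `n`-th term of the series of
`phi`, leaving an exponential series. With absolute values it is the series of `exp (t² /
(4(s+1)))`, which justifies termwise integration. -/
lemma integral_phi_rayleighMeasure {s : ℝ} (hs : -(1 / 2) ≤ s) (t : ℝ) :
    ∫ r : ℝ≥0, phi s (t * r) ∂rayleighMeasure s = Real.exp (-(t ^ 2 / (4 * (s + 1)))) := by
  have hs1 : 0 < s + 1 := by linarith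
  set a : ℕ → ℝ := fun n => (-1) ^ n * (t / 2) ^ (2 * n) /
    (n.factorial * (ascPochhammer ℝ n).eval (s + 1)) with ha
  have hterm : ∀ (n : ℕ) (r : ℝ≥0), (-1) ^ n * (t * r / 2) ^ (2 * n) /
      (n.factorial * (ascPochhammer ℝ n).eval (s + 1)) = a n * (r : ℝ) ^ (2 * n) := by
    intro n r
    simp only [ha]
    rw [show t * r / 2 = (t / 2) * r by ring, mul_pow]
    ring
  have hmom : ∀ n : ℕ, a n * ((ascPochhammer ℝ n).eval (s + 1) / (s + 1) ^ n) =
      (-(t ^ 2 / (4 * (s + 1)))) ^ n / n.factorial := by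
    intro n
    have h2 := ascPochhammer_eval_pos hs n
    have : -(t ^ 2 / (4 * (s + 1))) = -1 * (t / 2) ^ 2 / (s + 1) := by field_simp; norm_num
    rw [this]
    simp only [ha]
    rw [div_pow _ (s + 1), mul_pow, pow_mul (t / 2)]
    field_simp
  have habs : ∀ n, |a n| * ((ascPochhammer ℝ n).eval (s + 1) / (s + 1) ^ n) =
      (t ^ 2 / (4 * (s + 1))) ^ n / n.factorial := by
    intro n
    have h2 := ascPochhammer_eval_pos hs n
    have h3 : 0 < (ascPochhammer ℝ n).eval (s + 1) / (s + 1) ^ n := by positivity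
    have h4 : 0 ≤ t ^ 2 / (4 * (s + 1)) := by positivity
    rw [← abs_of_pos h3, ← abs_mul, hmom, abs_div, abs_pow, abs_neg, abs_of_nonneg h4,
      Nat.abs_cast]
  have h := hasSum_integral_of_summable_integral_norm (μ := rayleighMeasure s)
    (F := fun n (r : ℝ≥0) => a n * (r : ℝ) ^ (2 * n))
    (fun n => (integrable_pow_rayleighMeasure hs n).const_mul _) (by
      refine (Real.summable_pow_div_factorial (t ^ 2 / (4 * (s + 1)))).congr fun n => ?_
      rw [← habs, ← integral_pow_rayleighMeasure hs, ← integral_const_mul]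
      refine integral_congr_ae (Filter.Eventually.of_forall fun r => ?_)
      simp)
  have e1 : ∀ r : ℝ≥0, ∑' n, a n * (r : ℝ) ^ (2 * n) = phi s (t * r) := fun r => by
    rw [← (hasSum_phi hs (t * r)).tsum_eq]
    exact tsum_congr fun n => (hterm n r).symm
  simp_rw [e1, integral_const_mul, integral_pow_rayleighMeasure hs, hmom] at h
  refine h.unique ?_
  rw [Real.exp_eq_exp_ℝ]
  exact NormedSpace.exp_series_hasSum_exp' (𝕂 := ℝ) (-(t ^ 2 / (4 * (s + 1)))) |>.congr_fun (by
    intro n; rw [smul_eq_mul]; ring)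

/-! ### Mixtures as images of product measures -/

/-- Realises a mixture as the law of a function of two independent variables, which makes Fubini and
weak continuity of products and pushforwards available. -/
lemma bind_map_eq_map_prod {X Y Z : Type*} [MeasurableSpace X] [MeasurableSpace Y]
    [MeasurableSpace Z] (μ : Measure X) (ν : Measure Y) [SFinite ν] {f : X → Y → Z}
    (hf : Measurable (Function.uncurry f)) :
    μ.bind (fun x => ν.map (f x)) = (μ.prod ν).map (Function.uncurry f) := by
  ext S hS
  have hfx : ∀ x, Measurable (f x) := fun x => hf.comp measurable_prodMk_left
  rw [Measure.bind_apply hS (measurable_map_section ν hf).aemeasurable, Measure.map_apply hf hS,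
    Measure.prod_apply (hf hS)]
  refine lintegral_congr fun x => ?_
  rw [Measure.map_apply (hfx x) hS]
  rfl

/-- The law of `k` independent variables with law `F_s`. -/
def thetaPi (s : ℝ) (hs : -(1 / 2) ≤ s) (k : ℕ) : ProbabilityMeasure (Fin k → ℝ) :=
  ⟨Measure.pi fun _ => (thetaLaw s hs : Measure ℝ), inferInstance⟩

lemma coe_thetaLaw (s : ℝ) (hs : -(1 / 2) ≤ s) : (thetaLaw s hs : Measure ℝ) = thetaMeasure s := rfl

lemma pi_map_thetaLaw {Z : Type*} [MeasurableSpace Z] (s : ℝ) (hs : -(1 / 2) ≤ s)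
    {f : Fin k → ℝ → Z} (hf : ∀ j, Measurable (f j)) :
    (Measure.pi fun j => (thetaLaw s hs : Measure ℝ).map (f j)) =
      (thetaPi s hs k : Measure (Fin k → ℝ)).map fun u j => f j (u j) := by
  have (j : Fin k) : IsProbabilityMeasure ((thetaLaw s hs : Measure ℝ).map (f j)) :=
    Measure.isProbabilityMeasure_map (hf j).aemeasurable
  exact (Measure.pi_map_pi fun j => (hf j).aemeasurable).symm

/-- The vector `(c₁ u₁, …, c_k u_k)`. -/
def scaledVector (p : (Fin k → ℝ≥0) × (Fin k → ℝ)) : EuclideanSpace ℝ (Fin k) :=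
  WithLp.toLp 2 fun j => (p.1 j : ℝ) * p.2 j

lemma continuous_scaledVector : Continuous (scaledVector (k := k)) := by
  unfold scaledVector; fun_prop

lemma measurable_scaledVector : Measurable (scaledVector (k := k)) :=
  continuous_scaledVector.measurable

lemma kingmanMap_eq_map (s : ℝ) (hs : -(1 / 2) ≤ s) (G : ProbabilityMeasure (Fin k → ℝ≥0)) :
    kingmanMap s hs G = (G.prod (thetaPi s hs k)).map measurable_scaledVector.aemeasurable := by
  refine Subtype.ext ?_
  change (G : Measure (Fin k → ℝ≥0)).bind (fun c => scaledProduct s hs c) =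
    ((G : Measure (Fin k → ℝ≥0)).prod (thetaPi s hs k : Measure (Fin k → ℝ))).map scaledVector
  rw [← Function.uncurry_curry scaledVector, ← bind_map_eq_map_prod _ _
    (by rw [Function.uncurry_curry]; exact measurable_scaledVector)]
  congr 1
  funext c
  rw [scaledProduct, pi_map_thetaLaw s hs (fun j => by fun_prop),
    Measure.map_map (by fun_prop) (by fun_prop)]
  rfl

lemma coe_kingmanMap (s : ℝ) (hs : -(1 / 2) ≤ s) (G : ProbabilityMeasure (Fin k → ℝ≥0)) :
    (kingmanMap s hs G : Measure (EuclideanSpace ℝ (Fin k))) =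
      ((G : Measure (Fin k → ℝ≥0)).prod (thetaPi s hs k : Measure (Fin k → ℝ))).map
        scaledVector := by
  rw [kingmanMap_eq_map]; rfl

/-- The vector of the side lengths of `k` triangles. -/
def sideVector (q : ((Fin k → ℝ≥0) × (Fin k → ℝ≥0)) × (Fin k → ℝ)) (j : Fin k) : ℝ≥0 :=
  sideLength (q.2 j) (q.1.1 j) (q.1.2 j)

lemma measurable_sideVector : Measurable (sideVector (k := k)) := by
  refine measurable_pi_iff.2 fun j => ?_
  unfold sideVector sideLength
  fun_prop

lemma coe_kingmanConv (s : ℝ) (hs : -(1 / 2) ≤ s) (G₁ G₂ : ProbabilityMeasure (Fin k → ℝ≥0)) :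
    (kingmanConv s hs G₁ G₂ : Measure (Fin k → ℝ≥0)) =
      (((G₁ : Measure (Fin k → ℝ≥0)).prod (G₂ : Measure (Fin k → ℝ≥0))).prod
        (thetaPi s hs k : Measure (Fin k → ℝ))).map sideVector := by
  rw [← Function.uncurry_curry sideVector, ← bind_map_eq_map_prod _ _
    (by rw [Function.uncurry_curry]; exact measurable_sideVector)]
  change Measure.bind _ _ = _
  congr 1
  funext p
  exact pi_map_thetaLaw s hs (f := fun j u => sideLength u (p.1 j) (p.2 j))
    fun j => measurable_sideLength_left _ _

/-! ### Fourier transforms -/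

/-- The product `∏ⱼ Λ_s(tⱼ cⱼ)`, for real `tⱼ`. -/
def phiProd (s : ℝ) (t : Fin k → ℝ) (c : Fin k → ℝ≥0) : ℝ := ∏ j, phi s (t j * c j)

lemma measurable_phiProd {s : ℝ} (hs : -(1 / 2) ≤ s) :
    Measurable (Function.uncurry (phiProd (k := k) s)) := by
  change Measurable fun p : (Fin k → ℝ) × (Fin k → ℝ≥0) => ∏ j, phi s (p.1 j * p.2 j)
  refine Finset.measurable_prod _ fun j _ => (measurable_phi hs).comp ?_
  fun_prop

lemma abs_phiProd_le_one {s : ℝ} (hs : -(1 / 2) ≤ s) (t : Fin k → ℝ) (c : Fin k → ℝ≥0) :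
    |phiProd s t c| ≤ 1 := by
  rw [phiProd, Finset.abs_prod]
  exact Finset.prod_le_one (fun _ _ => abs_nonneg _) fun _ _ => abs_phi_le_one hs _

lemma integral_exp_thetaPi {s : ℝ} (hs : -(1 / 2) ≤ s) (t : Fin k → ℝ) (c : Fin k → ℝ≥0) :
    ∫ u : Fin k → ℝ, Complex.exp ((∑ j, t j * (c j * u j) : ℝ) * Complex.I)
      ∂(thetaPi s hs k : Measure (Fin k → ℝ)) = (phiProd s t c : ℂ) := by
  have := isProbabilityMeasure_thetaMeasure hs
  have h := integral_fintype_prod_eq_prod (𝕜 := ℂ) (μ := fun _ : Fin k => thetaMeasure s)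
    (fun j (u : ℝ) => Complex.exp ((t j * c j : ℝ) * u * Complex.I))
  simp_rw [integral_exp_thetaMeasure hs] at h
  rw [phiProd, Complex.ofReal_prod, ← h]
  refine integral_congr_ae (Filter.Eventually.of_forall fun u => ?_)
  simp only
  rw [← Complex.exp_sum, Complex.ofReal_sum, Finset.sum_mul]
  congr 1
  refine Finset.sum_congr rfl fun j _ => ?_
  push_cast
  ring

lemma charFun_kingmanMap {s : ℝ} (hs : -(1 / 2) ≤ s) (G : ProbabilityMeasure (Fin k → ℝ≥0))
    (t : EuclideanSpace ℝ (Fin k)) :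
    charFun (kingmanMap s hs G : Measure (EuclideanSpace ℝ (Fin k))) t =
      ((∫ c, phiProd s t c ∂(G : Measure (Fin k → ℝ≥0)) : ℝ) : ℂ) := by
  have hm : Measurable fun p : (Fin k → ℝ≥0) × (Fin k → ℝ) =>
      ∑ j, t j * ((p.1 j : ℝ) * p.2 j) := by fun_prop
  have e : ∀ p : (Fin k → ℝ≥0) × (Fin k → ℝ),
      inner ℝ (scaledVector p) t = ∑ j, t j * ((p.1 j : ℝ) * p.2 j) := fun p => by
    simp [scaledVector, PiLp.inner_apply]
  rw [charFun_apply, coe_kingmanMap, integral_map measurable_scaledVector.aemeasurable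
    (by fun_prop)]
  simp_rw [e]
  rw [integral_prod _ (integrable_exp_mul_I _ hm), ← integral_complex_ofReal]
  exact integral_congr_ae (Filter.Eventually.of_forall fun c => integral_exp_thetaPi hs t c)

lemma kingmanMap_eq_of_integral {s : ℝ} (hs : -(1 / 2) ≤ s) {G : ProbabilityMeasure (Fin k → ℝ≥0)}
    {P : ProbabilityMeasure (EuclideanSpace ℝ (Fin k))}
    (h : ∀ t : EuclideanSpace ℝ (Fin k),
      ((∫ c, phiProd s t c ∂(G : Measure (Fin k → ℝ≥0)) : ℝ) : ℂ) =
        charFun (P : Measure (EuclideanSpace ℝ (Fin k))) t) : kingmanMap s hs G = P :=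
  Subtype.ext <| show (kingmanMap s hs G : Measure (EuclideanSpace ℝ (Fin k))) = P from
    Measure.ext_of_charFun (funext fun t => (charFun_kingmanMap hs G t).trans (h t))

lemma radialCharFun_eq_charFun {s : ℝ} (hs : -(1 / 2) ≤ s) (G : ProbabilityMeasure (Fin k → ℝ≥0))
    (t : Fin k → ℝ≥0) : (radialCharFun s G t : ℂ) =
      charFun (kingmanMap s hs G : Measure (EuclideanSpace ℝ (Fin k)))
        (WithLp.toLp 2 fun j => (t j : ℝ)) := by
  rw [charFun_kingmanMap hs]
  congr 1
  refine integral_congr_ae (Filter.Eventually.of_forall fun c => ?_)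
  exact Finset.prod_congr rfl fun j _ => (phi_eq_kernel s (by positivity)).symm

/-! ### Algebraic properties of `F_{s,k}` -/

lemma integral_phiProd_sideLength {s : ℝ} (hs : -(1 / 2) ≤ s) (t : Fin k → ℝ)
    (x y : Fin k → ℝ≥0) :
    ∫ u : Fin k → ℝ, phiProd s t (fun j => sideLength (u j) (x j) (y j))
      ∂(thetaPi s hs k : Measure (Fin k → ℝ)) = phiProd s t x * phiProd s t y := by
  have := isProbabilityMeasure_thetaMeasure hs
  have h := integral_fintype_prod_eq_prod (𝕜 := ℝ) (μ := fun _ : Fin k => thetaMeasure s)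
    (fun j (u : ℝ) => phi s (t j * sideLength u (x j) (y j)))
  simp_rw [integral_phi_sideLength hs, Finset.prod_mul_distrib] at h
  exact h

/-- With the pair of side vectors held fixed, integrating out the `k` independent variables of law
`F_s` applies the product formula in each coordinate; the remaining integral over `G₁ × G₂`
factorises. -/
lemma kingmanMap_kingmanConv {s : ℝ} (hs : -(1 / 2) ≤ s)
    (G₁ G₂ : ProbabilityMeasure (Fin k → ℝ≥0)) :
    kingmanMap s hs (kingmanConv s hs G₁ G₂) =
      ordConv (kingmanMap s hs G₁) (kingmanMap s hs G₂) := by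
  refine kingmanMap_eq_of_integral hs fun t => ?_
  have hmt : Measurable (phiProd s t) := (measurable_phiProd (k := k) hs).comp
    (measurable_prodMk_left (x := WithLp.ofLp t))
  change _ = charFun ((kingmanMap s hs G₁ : Measure (EuclideanSpace ℝ (Fin k))).conv
    (kingmanMap s hs G₂ : Measure (EuclideanSpace ℝ (Fin k)))) t
  rw [charFun_conv, charFun_kingmanMap, charFun_kingmanMap, ← Complex.ofReal_mul,
    ← integral_prod_mul, coe_kingmanConv,
    integral_map measurable_sideVector.aemeasurable hmt.aestronglyMeasurable, integral_prod]
  · congr 1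
    exact integral_congr_ae (Filter.Eventually.of_forall fun p =>
      integral_phiProd_sideLength hs t p.1 p.2)
  · exact Integrable.of_bound (hmt.comp measurable_sideVector).aestronglyMeasurable 1
      (Filter.Eventually.of_forall fun p => abs_phiProd_le_one hs t _)

lemma phi_zero (s : ℝ) : phi s 0 = 1 := by simp [phi, kernel]

lemma kingmanMap_pointMass_zero {s : ℝ} (hs : -(1 / 2) ≤ s) :
    kingmanMap s hs (pointMass (0 : Fin k → ℝ≥0)) = pointMass 0 := by
  refine kingmanMap_eq_of_integral hs fun t => ?_
  change ((∫ c, phiProd s t c ∂Measure.dirac 0 : ℝ) : ℂ) = charFun (Measure.dirac 0) t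
  rw [integral_dirac, charFun_dirac]
  simp [phiProd, phi_zero]

lemma kingmanMap_convexComb {s : ℝ} (hs : -(1 / 2) ≤ s) {n : ℕ} (w : Fin n → ℝ≥0)
    (hw : ∑ i, w i = 1) (G : Fin n → ProbabilityMeasure (Fin k → ℝ≥0)) :
    kingmanMap s hs (convexComb w hw G) = convexComb w hw fun i => kingmanMap s hs (G i) := by
  refine Subtype.ext (Measure.ext fun S hS => ?_)
  change (∑ i, w i • (G i : Measure (Fin k → ℝ≥0))).bind (fun c => scaledProduct s hs c) S =
    (∑ i, w i • (G i : Measure (Fin k → ℝ≥0)).bind (fun c => scaledProduct s hs c)) S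
  rw [Measure.bind_apply hS ((measurable_scaledProduct (k := k) s hs).aemeasurable),
    lintegral_finsetSum_measure, Measure.coe_finsetSum, Finset.sum_apply]
  refine Finset.sum_congr rfl fun i _ => ?_
  rw [lintegral_smul_measure, Measure.smul_apply,
    Measure.bind_apply hS ((measurable_scaledProduct (k := k) s hs).aemeasurable)]

lemma kingmanMap_scale {s : ℝ} (hs : -(1 / 2) ≤ s) (c : ℝ≥0)
    (G : ProbabilityMeasure (Fin k → ℝ≥0)) :
    kingmanMap s hs (scale c G) = scale c (kingmanMap s hs G) := by
  refine kingmanMap_eq_of_integral hs fun t => ?_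
  have hmt : Measurable (phiProd s t) := (measurable_phiProd (k := k) hs).comp
    (measurable_prodMk_left (x := WithLp.ofLp t))
  change ((∫ x, phiProd s t x ∂((G : Measure (Fin k → ℝ≥0)).map fun x => c • x) : ℝ) : ℂ) =
    charFun ((kingmanMap s hs G : Measure (EuclideanSpace ℝ (Fin k))).map fun x => (c : ℝ) • x) t
  rw [charFun_map_smul, charFun_kingmanMap,
    integral_map (measurable_const_smul c).aemeasurable hmt.aestronglyMeasurable]
  congr 1
  refine integral_congr_ae (Filter.Eventually.of_forall fun x => ?_)
  refine Finset.prod_congr rfl fun j _ => ?_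
  simp only [PiLp.smul_apply, Pi.smul_apply, smul_eq_mul, NNReal.coe_mul]
  ring_nf

/-! ### The image of the Rayleigh law -/

lemma integral_phiProd_rayleighLaw {s : ℝ} (hs : -(1 / 2) ≤ s) (t : Fin k → ℝ) :
    ∫ c, phiProd s t c ∂(rayleighLaw s hs k : Measure (Fin k → ℝ≥0)) =
      Real.exp (-∑ j, t j ^ 2 / (4 * (s + 1))) := by
  have := isProbabilityMeasure_rayleighMeasure hs
  have h := integral_fintype_prod_eq_prod (𝕜 := ℝ) (μ := fun _ : Fin k => rayleighMeasure s)
    (fun j (r : ℝ≥0) => phi s (t j * r))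
  simp_rw [integral_phi_rayleighMeasure hs, ← Real.exp_sum, Finset.sum_neg_distrib] at h
  exact h

lemma kingmanMap_rayleighLaw {s : ℝ} (hs : -(1 / 2) ≤ s) :
    (kingmanMap s hs (rayleighLaw s hs k) : Measure (EuclideanSpace ℝ (Fin k))) =
      multivariateGaussian 0 ((2 * (s + 1))⁻¹ • (1 : Matrix (Fin k) (Fin k) ℝ)) := by
  have hs1 : 0 < s + 1 := by linarith
  refine Measure.ext_of_charFun (funext fun t => ?_)
  rw [charFun_kingmanMap, charFun_multivariateGaussian
    (Matrix.PosSemidef.one.smul (by positivity)), integral_phiProd_rayleighLaw, Complex.ofReal_exp]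
  congr 1
  simp only [inner_zero_right, Complex.ofReal_zero, zero_mul, zero_sub, Matrix.smul_mulVec,
    Matrix.one_mulVec, dotProduct_smul, smul_eq_mul]
  push_cast
  rw [dotProduct, ← Finset.sum_div, Complex.ofReal_sum]
  have : (s : ℂ) + 1 ≠ 0 := by exact_mod_cast hs1.ne'
  simp only [← sq]
  field_simp
  norm_num [mul_comm]

/-! ### Injectivity of `F_{s,k}` -/

open scoped BoundedContinuousFunction

/-- The function `exp (-∑ⱼ bⱼ xⱼ²)` on the orthant. -/
def gaussFun (b : Fin k → ℝ≥0) : (Fin k → ℝ≥0) →ᵇ ℝ :=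
  BoundedContinuousFunction.ofNormedAddCommGroup
    (fun x => Real.exp (-∑ j, (b j : ℝ) * (x j : ℝ) ^ 2)) (by fun_prop) 1 fun x => by
      rw [Real.norm_eq_abs, Real.abs_exp]
      exact Real.exp_le_one_iff.2 (neg_nonpos.2 (Finset.sum_nonneg fun j _ => by positivity))

lemma gaussFun_apply (b x : Fin k → ℝ≥0) :
    gaussFun b x = Real.exp (-∑ j, (b j : ℝ) * (x j : ℝ) ^ 2) := rfl

lemma gaussFun_zero : gaussFun (0 : Fin k → ℝ≥0) = 1 := by
  ext x; simp [gaussFun_apply]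

lemma gaussFun_add (b b' : Fin k → ℝ≥0) : gaussFun (b + b') = gaussFun b * gaussFun b' := by
  ext x
  simp [gaussFun_apply, ← Real.exp_add, add_mul, Finset.sum_add_distrib, add_comm]

/-- The functions `exp (-∑ⱼ bⱼ xⱼ²)` as a submonoid. -/
def gaussSubmonoid (k : ℕ) : Submonoid ((Fin k → ℝ≥0) →ᵇ ℝ) where
  carrier := Set.range gaussFun
  one_mem' := ⟨0, gaussFun_zero⟩
  mul_mem' := by
    rintro _ _ ⟨b, rfl⟩ ⟨b', rfl⟩
    exact ⟨b + b', gaussFun_add b b'⟩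

/-- The algebra spanned by the functions `exp (-∑ⱼ bⱼ xⱼ²)`. -/
def gaussAlgebra (k : ℕ) : StarSubalgebra ℝ ((Fin k → ℝ≥0) →ᵇ ℝ) where
  toSubalgebra := Algebra.adjoin ℝ (gaussSubmonoid k : Set ((Fin k → ℝ≥0) →ᵇ ℝ))
  star_mem' := by
    intro f hf
    rwa [show star f = f by ext x; simp]

lemma separatesPoints_gaussAlgebra : ((gaussAlgebra k).map
    (BoundedContinuousFunction.toContinuousMapStarₐ ℝ)).SeparatesPoints := by
  intro x y hxy
  obtain ⟨j, hj⟩ := Function.ne_iff.1 hxy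
  -- The function `exp (-xⱼ²)` suffices because squaring is injective on nonnegative numbers.
  refine ⟨gaussFun (Pi.single j 1), ⟨(gaussFun (Pi.single j 1)).toContinuousMap,
    ⟨gaussFun (Pi.single j 1), Algebra.subset_adjoin ⟨_, rfl⟩, rfl⟩, rfl⟩, ?_⟩
  have e : ∀ z : Fin k → ℝ≥0,
      gaussFun (Pi.single j 1) z = Real.exp (-(z j : ℝ) ^ 2) := fun z => by
    rw [gaussFun_apply, Finset.sum_eq_single j]
    · simp
    · intro i _ hi; simp [hi]
    · simp
  rw [e, e, Ne, Real.exp_eq_exp, neg_inj, sq_eq_sq₀ (by positivity) (by positivity)]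
  exact_mod_cast hj

lemma ext_of_integral_gaussFun {μ ν : Measure (Fin k → ℝ≥0)} [IsFiniteMeasure μ]
    [IsFiniteMeasure ν] (h : ∀ b, ∫ x, gaussFun b x ∂μ = ∫ x, gaussFun b x ∂ν) : μ = ν := by
  refine ext_of_forall_mem_subalgebra_integral_eq_of_polish (𝕜 := ℝ) (A := gaussAlgebra k)
    separatesPoints_gaussAlgebra fun g hg => ?_
  -- The generators are closed under products, so the algebra is their linear span and linearity of
  -- the integral is enough.
  have hg' : g ∈ Submodule.span ℝ (gaussSubmonoid k : Set ((Fin k → ℝ≥0) →ᵇ ℝ)) := by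
    have := Algebra.adjoin_eq_span ℝ (gaussSubmonoid k : Set ((Fin k → ℝ≥0) →ᵇ ℝ))
    rw [Submonoid.closure_eq] at this
    rw [← this]
    exact hg
  clear hg
  induction hg' using Submodule.span_induction with
  | mem f hf => obtain ⟨b, rfl⟩ := hf; exact h b
  | zero => simp
  | add f₁ f₂ h₁ h₂ ih₁ ih₂ =>
    simp only [BoundedContinuousFunction.coe_add, Pi.add_apply]
    rw [integral_add (f₁.integrable μ) (f₂.integrable μ),
      integral_add (f₁.integrable ν) (f₂.integrable ν)]
    rw [ih₁, ih₂]
  | smul c f hf ih =>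
    simp only [BoundedContinuousFunction.coe_smul, integral_smul]
    rw [ih]

/-- Expresses Gaussian integrals of `G` through its transform alone. The scale `2√((s+1)bⱼ)` is
chosen so that `t²/(4(s+1))` at `t = 2√((s+1)bⱼ) xⱼ` equals `bⱼ xⱼ²`. -/
lemma integral_gaussFun {s : ℝ} (hs : -(1 / 2) ≤ s) (G : ProbabilityMeasure (Fin k → ℝ≥0))
    (b : Fin k → ℝ≥0) :
    ∫ x, gaussFun b x ∂(G : Measure (Fin k → ℝ≥0)) =
      ∫ r, (∫ x, phiProd s (fun j => 2 * √((s + 1) * b j) * r j) x ∂(G : Measure (Fin k → ℝ≥0)))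
        ∂(rayleighLaw s hs k : Measure (Fin k → ℝ≥0)) := by
  have hs1 : 0 < s + 1 := by linarith
  rw [integral_integral_swap]
  · refine integral_congr_ae (Filter.Eventually.of_forall fun x => ?_)
    -- After Fubini, frequency and space variable trade places, so the Rayleigh transform applies
    -- with `x` as part of the frequency.
    have e : ∀ r : Fin k → ℝ≥0, phiProd s (fun j => 2 * √((s + 1) * b j) * r j) x =
        phiProd s (fun j => 2 * √((s + 1) * b j) * x j) r := fun r =>
      Finset.prod_congr rfl fun j _ => by ring_nf
    simp only [e]
    rw [integral_phiProd_rayleighLaw hs, gaussFun_apply]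
    congr 2
    refine Finset.sum_congr rfl fun j _ => ?_
    rw [mul_pow, mul_pow, Real.sq_sqrt (by positivity)]
    field_simp
    norm_num
  · refine Integrable.of_bound (C := 1) ?_ (Filter.Eventually.of_forall fun p =>
      abs_phiProd_le_one hs _ _)
    refine Measurable.aestronglyMeasurable ((measurable_phiProd hs).comp
      (f := fun p : (Fin k → ℝ≥0) × (Fin k → ℝ≥0) =>
        ((fun j => 2 * √((s + 1) * b j) * p.1 j : Fin k → ℝ), p.2)) ?_)
    fun_prop

lemma kingmanMap_injective {s : ℝ} (hs : -(1 / 2) ≤ s) :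
    Function.Injective (kingmanMap (k := k) s hs) := by
  intro G₁ G₂ h
  refine Subtype.ext (ext_of_integral_gaussFun (μ := (G₁ : Measure (Fin k → ℝ≥0)))
    (ν := (G₂ : Measure (Fin k → ℝ≥0))) fun b => ?_)
  rw [integral_gaussFun hs, integral_gaussFun hs]
  refine integral_congr_ae (Filter.Eventually.of_forall fun r => ?_)
  have h1 := charFun_kingmanMap hs G₁ (WithLp.toLp 2 fun j => 2 * √((s + 1) * b j) * r j)
  rw [h, charFun_kingmanMap] at h1
  exact_mod_cast h1.symm

/-! ### `F_{s,k}` is a closed embedding -/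

lemma continuous_kingmanMap {s : ℝ} (hs : -(1 / 2) ≤ s) :
    Continuous (kingmanMap (k := k) s hs) := by
  have h : kingmanMap (k := k) s hs = fun G =>
      (G.prod (thetaPi s hs k)).map measurable_scaledVector.aemeasurable :=
    funext fun G => kingmanMap_eq_map s hs G
  rw [h]
  exact (ProbabilityMeasure.continuous_map continuous_scaledVector).comp
    (ProbabilityMeasure.continuous_prod.comp (continuous_id.prodMk continuous_const))

/-- Otherwise `F_s` would be concentrated at 0, against its positive second moment. -/
lemma exists_thetaMeasure_lt_abs_pos {s : ℝ} (hs : -(1 / 2) ≤ s) :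
    ∃ δ > 0, thetaMeasure s {u | δ < |u|} ≠ 0 := by
  by_contra! hcon
  have h0 : ∀ᵐ u ∂thetaMeasure s, u = 0 := by
    have : ∀ n : ℕ, ∀ᵐ u ∂thetaMeasure s, |u| ≤ 1 / ((n : ℝ) + 1) := fun n => by
      have := hcon (1 / ((n : ℝ) + 1)) (by positivity)
      rw [ae_iff]
      simpa using this
    filter_upwards [ae_all_iff.2 this] with u hu
    by_contra hne
    obtain ⟨n, hn⟩ := exists_nat_one_div_lt (abs_pos.2 hne)
    exact absurd (hu n) (not_le.2 hn)
  have h1 := integral_even_pow_thetaMeasure hs 1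
  have h2 : ∫ u, u ^ (2 * 1) ∂thetaMeasure s = 0 := by
    rw [integral_eq_zero_of_ae]
    filter_upwards [h0] with u hu
    simp [hu]
  have h3 : 0 < evenMoment s 1 := by
    have := ascPochhammer_eval_pos hs 1
    unfold evenMoment; positivity
  linarith

/-- If some `cⱼ > M` and `|uⱼ| > δ`, then `|cⱼ uⱼ| > M δ ≥ R`. Since `j` depends on `c`, all
coordinates of `u` are required to exceed `δ`, which by independence costs a `k`-th power. -/
lemma mul_measure_le_kingmanMap {s : ℝ} (hs : -(1 / 2) ≤ s)
    (G : ProbabilityMeasure (Fin k → ℝ≥0)) {δ R : ℝ} (hδ : 0 < δ) {M : ℝ≥0} (hM : R ≤ M * δ)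
    {C : Set (EuclideanSpace ℝ (Fin k))} (hC : C ⊆ Metric.closedBall 0 R) :
    (G : Measure (Fin k → ℝ≥0)) (Set.univ.pi fun _ => Set.Icc 0 M)ᶜ *
      thetaMeasure s {u | δ < |u|} ^ k ≤
      (kingmanMap s hs G : Measure (EuclideanSpace ℝ (Fin k))) Cᶜ := by
  have := isProbabilityMeasure_thetaMeasure hs
  have hpi : (thetaPi s hs k : Measure (Fin k → ℝ)) (Set.univ.pi fun _ => {u | δ < |u|}) =
      thetaMeasure s {u | δ < |u|} ^ k := by
    change Measure.pi (fun _ => thetaMeasure s) _ = _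
    rw [Measure.pi_pi]; simp
  rw [← hpi, ← Measure.prod_prod, coe_kingmanMap]
  refine le_trans (measure_mono ?_) (Measure.le_map_apply measurable_scaledVector.aemeasurable _)
  rintro ⟨c, u⟩ ⟨hc, hu⟩ hmem
  have hnorm : ‖scaledVector (c, u)‖ ≤ R := by simpa using hC hmem
  simp only [Set.mem_compl_iff, Set.mem_univ_pi, Set.mem_Icc, zero_le, true_and, not_forall,
    not_le] at hc
  obtain ⟨j, hj⟩ := hc
  have huj : δ < |u j| := hu j trivial
  have hj' : (M : ℝ) < c j := hj
  have h1 : |(c j : ℝ) * u j| ≤ ‖scaledVector (c, u)‖ :=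
    PiLp.norm_apply_le (scaledVector (c, u)) j
  rw [abs_mul, NNReal.abs_eq] at h1
  have h2 : (M : ℝ) * δ < c j * |u j| := by
    calc (M : ℝ) * δ ≤ M * |u j| := by gcongr
      _ < c j * |u j| := mul_lt_mul_of_pos_right hj' (hδ.trans huj)
  linarith

/-- Prokhorov's theorem is used in both directions: compactness of `K` gives tightness, the
preceding estimate transfers it to the preimage, and a closed tight set is compact. -/
lemma isCompact_preimage_kingmanMap {s : ℝ} (hs : -(1 / 2) ≤ s)
    {K : Set (ProbabilityMeasure (EuclideanSpace ℝ (Fin k)))} (hK : IsCompact K) :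
    IsCompact (kingmanMap s hs ⁻¹' K) := by
  have hclosed : IsClosed (kingmanMap (k := k) s hs ⁻¹' K) :=
    hK.isClosed.preimage (continuous_kingmanMap hs)
  rw [← hclosed.closure_eq]
  have htight := isTightMeasureSet_of_isCompact_closure (S := K) (hK.isClosed.closure_eq.symm ▸ hK)
  refine isCompact_closure_of_isTightMeasureSet ?_
  rw [isTightMeasureSet_iff_exists_isCompact_measure_compl_le] at htight ⊢
  intro ε hε
  have := isProbabilityMeasure_thetaMeasure hs
  obtain ⟨δ, hδ, hpos⟩ := exists_thetaMeasure_lt_abs_pos hs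
  set q := thetaMeasure s {u | δ < |u|} ^ k with hq
  have hq0 : q ≠ 0 := pow_ne_zero _ hpos
  have hqtop : q ≠ ∞ := ENNReal.pow_ne_top (measure_ne_top _ _)
  -- The tolerance `ε * q` absorbs the factor `q` lost in the estimate, which is cancelled at the
  -- end.
  obtain ⟨C, hC, hCle⟩ := htight (ε * q) (pos_iff_ne_zero.2 (mul_ne_zero hε.ne' hq0))
  obtain ⟨R, hR⟩ := hC.isBounded.subset_closedBall 0
  refine ⟨Set.univ.pi fun _ => Set.Icc 0 (Real.toNNReal (R / δ)),
    isCompact_univ_pi fun _ => isCompact_Icc, ?_⟩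
  rintro _ ⟨G, hG, rfl⟩
  have h1 := mul_measure_le_kingmanMap hs G hδ (M := Real.toNNReal (R / δ))
    ((div_le_iff₀ hδ).1 (Real.le_coe_toNNReal _)) hR
  have h2 := h1.trans (hCle _ ⟨_, hG, rfl⟩)
  exact (ENNReal.mul_le_mul_iff_left hq0 hqtop).1 h2

lemma isClosedEmbedding_kingmanMap {s : ℝ} (hs : -(1 / 2) ≤ s) :
    IsClosedEmbedding (kingmanMap (k := k) s hs) :=
  .of_continuous_injective_isClosedMap (continuous_kingmanMap hs) (kingmanMap_injective hs)
    (isProperMap_iff_isCompact_preimage.2 ⟨continuous_kingmanMap hs,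
      fun _ hK => isCompact_preimage_kingmanMap hs hK⟩).isClosedMap

end

end Kingman

theorem mainTheorem4 (s : ℝ) (hs : -(1 / 2) ≤ s) (k : ℕ) (hk : 1 ≤ k) :
    -- `F_s` has characteristic function `Λ_s`
    (∀ t : ℝ, 0 ≤ t → charFun (Kingman.thetaLaw s hs : Measure ℝ) t = (Kingman.kernel s t : ℂ)) ∧
    -- the image of `F_{s,k}` is weakly closed
    IsClosed (Set.range (Kingman.kingmanMap (k := k) s hs)) ∧
    -- the image of `F_{s,k}` is closed under ordinary convolution
    (∀ P ∈ Set.range (Kingman.kingmanMap (k := k) s hs),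
      ∀ Q ∈ Set.range (Kingman.kingmanMap (k := k) s hs),
        Kingman.ordConv P Q ∈ Set.range (Kingman.kingmanMap (k := k) s hs)) ∧
    -- the radial characteristic function of `G` is the Fourier transform of `F_{s,k}(G)`
    (∀ (G : ProbabilityMeasure (Fin k → ℝ≥0)) (t : Fin k → ℝ≥0),
      (Kingman.radialCharFun s G t : ℂ) =
        charFun (Kingman.kingmanMap s hs G : Measure (EuclideanSpace ℝ (Fin k)))
          (WithLp.toLp 2 fun j => (t j : ℝ))) ∧
    -- `F_{s,k}` is a homomorphism of convolution algebras
    (∀ G₁ G₂ : ProbabilityMeasure (Fin k → ℝ≥0),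
      Kingman.kingmanMap s hs (Kingman.kingmanConv s hs G₁ G₂) =
        Kingman.ordConv (Kingman.kingmanMap s hs G₁) (Kingman.kingmanMap s hs G₂)) ∧
    Kingman.kingmanMap s hs (Kingman.pointMass (0 : Fin k → ℝ≥0)) = Kingman.pointMass 0 ∧
    -- `F_{s,k}` commutes with convex combinations
    (∀ (n : ℕ) (w : Fin n → ℝ≥0) (hw : ∑ i, w i = 1)
      (G : Fin n → ProbabilityMeasure (Fin k → ℝ≥0)),
      Kingman.kingmanMap s hs (Kingman.convexComb w hw G) =
        Kingman.convexComb w hw fun i => Kingman.kingmanMap s hs (G i)) ∧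
    -- `F_{s,k}` commutes with scale changes
    (∀ c : ℝ≥0, 0 < c → ∀ G : ProbabilityMeasure (Fin k → ℝ≥0),
      Kingman.kingmanMap s hs (Kingman.scale c G) =
        Kingman.scale c (Kingman.kingmanMap s hs G)) ∧
    -- `F_{s,k}` sends the Rayleigh law to the centered normal law of covariance `(2(s+1))⁻¹ I`
    (Kingman.kingmanMap s hs (Kingman.rayleighLaw s hs k) :
        Measure (EuclideanSpace ℝ (Fin k))) =
      multivariateGaussian 0 ((2 * (s + 1))⁻¹ • (1 : Matrix (Fin k) (Fin k) ℝ)) ∧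
    -- `F_{s,k}` is a homeomorphism onto its image
    IsEmbedding (Kingman.kingmanMap (k := k) s hs) := by
  refine ⟨fun t ht => ?_, (Kingman.isClosedEmbedding_kingmanMap hs).isClosed_range, ?_,
    Kingman.radialCharFun_eq_charFun hs, Kingman.kingmanMap_kingmanConv hs,
    Kingman.kingmanMap_pointMass_zero hs, fun n w hw G => Kingman.kingmanMap_convexComb hs w hw G,
    fun c _ G => Kingman.kingmanMap_scale hs c G, Kingman.kingmanMap_rayleighLaw hs,
    (Kingman.isClosedEmbedding_kingmanMap hs).isEmbedding⟩
  · rw [Kingman.coe_thetaLaw, Kingman.charFun_thetaMeasure hs, Kingman.phi_eq_kernel s ht]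
  · rintro _ ⟨G₁, rfl⟩ _ ⟨G₂, rfl⟩
    exact ⟨Kingman.kingmanConv s hs G₁ G₂, Kingman.kingmanMap_kingmanConv hs G₁ G₂⟩
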